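/- Let $n,m\ge 1$ be integers with $2m\le n+1$, let $c_0,\dots,c_n$ be independent identically distributed real random variables with a continuous probability density $r$, $\mathbf E c_k=0$, $\mathbf E c_k^2=1$, and let $$f_n(x)=\sum_{k=0}^n\sqrt{\tbinom nk}\,c_k x^k .$$ Fix $\theta^0\in\mathbb R$. Let $x_j$ be the real zeros of $f_n$ and $\tau_j=\sqrt n\,(\arctan x_j-\theta^0)$ the scaled zeros, which lie in $U=\{y\in\mathbb R:\ |\theta^0+y/\sqrt n|<\pi/2\}$. For $y\in U$ with $\theta=\theta^0+y/\sqrt n\neq0$ put $$g_n(y)=\sum_{k=0}^n\mu_k(y)c_k,\qquad h_n(y)=\sum_{k=0}^n\lambda_k(y)c_k,$$ $$\mu_k(y)=\sin^k\theta\,\cos^{n-k}\theta\,\tbinom nk^{1/2},\qquad \lambda_k(y)=\frac{\mu_k(y)\sqrt n\,\bigl(\frac kn-\sin^2\theta\bigr)}{\sin\theta\cos\theta}.$$ For $y=(y_1,\dots,y_m)\in U^m$ with all $\theta^0+y_i/\sqrt n\ne0$, and $\xi,\eta\in\mathbb R^m$, let $D_{nm}(\xi,\eta;y)\in[0,\infty]$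 be the lower limit, as $\varepsilon\to0^+$, of $(2\varepsilon)^{-2m}$ times the probability that $|g_n(y_i)-\xi_i|<\varepsilon$ and $|h_n(y_i)-\eta_i|<\varepsilon$ for all $i$; this is the value at $(\xi,\eta)$ of the joint density of $(g_n(y_i))_i$ and $(h_n(y_i))_i$, and agrees with every version of that density that is continuous at $(\xi,\eta)$. Then: (1) If $y_1,\dots,y_m\in U$ are pairwise distinct and all $\theta^0+y_i/\sqrt n\neq0$, the joint distribution of the random vectors $(g_n(y_1),\dots,g_n(y_m))$ and $(h_n(y_1),\dots,h_n(y_m))$ is absolutely continuous on $\mathbb R^{2m}$ with density $(\xi,\eta)\mapsto D_{nm}(\xi,\eta;y)$. (2) The $m$-point correlation function of the scaled zeros is $$K_{nm}(y_1,\dots,y_m)=\int_{\mathbb R^m}|\eta_1\cdots\eta_m|\,D_{nm}(0,\eta;y_1,\dots,y_m)\,d\eta_1\cdots d\eta_m ,$$ that is, $K_{nm}$ is measurable on $U^m$ and for every Borel set $B\subseteq U^m$ the expected number of ordered $m$-tuples of pairwise distinct scaled zeros $(\tau_{j_1},\dots,\tau_{j_m})\in B$ equals $\int_B K_{nm}(y)\,dy$.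 -/

import Mathlib

open Real Set Filter Topology MeasureTheory ProbabilityTheory
open scoped ENNReal BigOperators

noncomputable section

/-- The random polynomial `f_n(x) = ∑_{k=0}^n √(n choose k) c_k x^k`. -/
def randPoly {Ω : Type*} {n : ℕ} (c : Fin (n + 1) → Ω → ℝ) (ω : Ω) (x : ℝ) : ℝ :=
  ∑ k : Fin (n + 1), √((n.choose k : ℕ) : ℝ) * c k ω * x ^ (k : ℕ)

/-- The scaled zeros `τ = √n (arctan x - θ⁰)`, where `x` runs over the real zeros of `f_n`. -/
def scaledZeros {Ω : Type*} {n : ℕ} (c : Fin (n + 1) → Ω → ℝ) (θ₀ : ℝ) (ω : Ω) : Set ℝ :=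
  {τ | ∃ x : ℝ, randPoly c ω x = 0 ∧ τ = √(n : ℝ) * (arctan x - θ₀)}

/-- The angle `θ = θ⁰ + y / √n` that corresponds to the scaled variable `y`. -/
def angle (n : ℕ) (θ₀ y : ℝ) : ℝ := θ₀ + y / √(n : ℝ)

/-- The range of the scaled variable: `θ⁰ + y / √n` lies in `(-π/2, π/2)`, the range of `arctan`. -/
def scaledRange (n : ℕ) (θ₀ : ℝ) : Set ℝ := {y | angle n θ₀ y ∈ Ioo (-(π / 2)) (π / 2)}

/-- The weight `μ_k(y) = sin^k θ cos^{n-k} θ √(n choose k)`, where `θ = θ⁰ + y / √n`. -/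
def weightMu (n : ℕ) (θ₀ : ℝ) (k : Fin (n + 1)) (y : ℝ) : ℝ :=
  sin (angle n θ₀ y) ^ (k : ℕ) * cos (angle n θ₀ y) ^ (n - (k : ℕ)) * √((n.choose k : ℕ) : ℝ)

/-- The weight `λ_k(y) = μ_k(y) √n (k/n - sin² θ) / (sin θ cos θ)`, where `θ = θ⁰ + y / √n`. -/
def weightLambda (n : ℕ) (θ₀ : ℝ) (k : Fin (n + 1)) (y : ℝ) : ℝ :=
  weightMu n θ₀ k y * √(n : ℝ) * (((k : ℕ) : ℝ) / (n : ℝ) - sin (angle n θ₀ y) ^ 2) /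
    (sin (angle n θ₀ y) * cos (angle n θ₀ y))

/-- `g_n(y) = ∑_k μ_k(y) c_k`. -/
def gField {Ω : Type*} {n : ℕ} (c : Fin (n + 1) → Ω → ℝ) (θ₀ y : ℝ) (ω : Ω) : ℝ :=
  ∑ k, weightMu n θ₀ k y * c k ω

/-- `h_n(y) = ∑_k λ_k(y) c_k`. -/
def hField {Ω : Type*} {n : ℕ} (c : Fin (n + 1) → Ω → ℝ) (θ₀ y : ℝ) (ω : Ω) : ℝ :=
  ∑ k, weightLambda n θ₀ k y * c k ω

/-- The joint distribution of the random vectors `ξ = (g_n(y_1), …, g_n(y_m))` and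
`η = (h_n(y_1), …, h_n(y_m))`. -/
def jointLaw {Ω : Type*} [MeasurableSpace Ω] (P : Measure Ω) {n m : ℕ}
    (c : Fin (n + 1) → Ω → ℝ) (θ₀ : ℝ) (y : Fin m → ℝ) :
    Measure ((Fin m → ℝ) × (Fin m → ℝ)) :=
  P.map (fun ω => (fun i => gField c θ₀ (y i) ω, fun i => hField c θ₀ (y i) ω))

/-- The value at the point `z` of the density of `ν` with respect to the reference measure: the
(lower) limit of `ν(B) / volume(B)` over balls `B` centred at `z` that shrink to `z`. For an
absolutely continuous `ν` on a Euclidean space it is a version of the Radon-Nikodym density, and by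
`pointDensity_withDensity` it is the value at `z` of every version that is continuous at `z`. -/
def pointDensity {E : Type*} [PseudoMetricSpace E] [MeasureSpace E] (ν : Measure E) (z : E) :
    ℝ≥0∞ :=
  liminf (fun ε : ℝ => ν (Metric.ball z ε) / volume (Metric.ball z ε)) (𝓝[>] 0)

theorem pointDensity_withDensity {E : Type*} [PseudoMetricSpace E] [ProperSpace E] [MeasureSpace E]
    [OpensMeasurableSpace E] [(volume : Measure E).IsOpenPosMeasure]
    [IsFiniteMeasureOnCompacts (volume : Measure E)] (f : E → ℝ≥0∞) (z : E)
    (hf : ContinuousAt f z) : pointDensity (volume.withDensity f) z = f z := by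
  unfold pointDensity
  apply Tendsto.liminf_eq
  have hpos : ∀ ε : ℝ, 0 < ε → volume (Metric.ball z ε) ≠ 0 := fun ε hε =>
    (Metric.measure_ball_pos volume z hε).ne'
  have hfin : ∀ ε : ℝ, volume (Metric.ball z ε) ≠ ∞ := fun ε => measure_ball_lt_top.ne
  rw [tendsto_order]
  refine ⟨fun a ha => ?_, fun b hb => ?_⟩
  · obtain ⟨a', ha', ha''⟩ := exists_between ha
    obtain ⟨δ, hδ, hball⟩ := Metric.eventually_nhds_iff_ball.1 (hf.eventually (lt_mem_nhds ha''))
    filter_upwards [Ioo_mem_nhdsGT hδ] with ε hε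
    refine ha'.trans_le ?_
    rw [ENNReal.le_div_iff_mul_le (Or.inl (hpos ε hε.1)) (Or.inl (hfin ε)),
      withDensity_apply _ Metric.isOpen_ball.measurableSet, ← setLIntegral_const]
    exact setLIntegral_mono' Metric.isOpen_ball.measurableSet
      fun x hx => (hball x (Metric.ball_subset_ball hε.2.le hx)).le
  · obtain ⟨b', hb', hb''⟩ := exists_between hb
    obtain ⟨δ, hδ, hball⟩ := Metric.eventually_nhds_iff_ball.1 (hf.eventually (gt_mem_nhds hb'))
    filter_upwards [Ioo_mem_nhdsGT hδ] with ε hε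
    refine lt_of_le_of_lt ?_ hb''
    rw [ENNReal.div_le_iff_le_mul (Or.inl (hpos ε hε.1)) (Or.inl (hfin ε)),
      withDensity_apply _ Metric.isOpen_ball.measurableSet, ← setLIntegral_const]
    exact setLIntegral_mono' Metric.isOpen_ball.measurableSet
      fun x hx => (hball x (Metric.ball_subset_ball hε.2.le hx)).le

/-- The joint density `D_{nm}(ξ, η; y_1, …, y_m)`. -/
def jointDensity {Ω : Type*} [MeasurableSpace Ω] (P : Measure Ω) {n m : ℕ}
    (c : Fin (n + 1) → Ω → ℝ) (θ₀ : ℝ) (ξ η : Fin m → ℝ) (y : Fin m → ℝ) : ℝ≥0∞ :=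
  pointDensity (jointLaw P c θ₀ y) (ξ, η)

/-- The Kac-Rice integral `∫ |η_1 ⋯ η_m| D_{nm}(0, η; y_1, …, y_m) dη`. -/
def kacRice {Ω : Type*} [MeasurableSpace Ω] (P : Measure Ω) {n m : ℕ}
    (c : Fin (n + 1) → Ω → ℝ) (θ₀ : ℝ) (y : Fin m → ℝ) : ℝ≥0∞ :=
  ∫⁻ η : Fin m → ℝ, ENNReal.ofReal |∏ i, η i| * jointDensity P c θ₀ 0 η y

/-- The number of ordered `m`-tuples of pairwise distinct points of `S` that lie in `B`. -/
def tupleCount {m : ℕ} (S : Set ℝ) (B : Set (Fin m → ℝ)) : ℝ≥0∞ :=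
  (({t : Fin m → ℝ | Function.Injective t ∧ (∀ i, t i ∈ S) ∧ t ∈ B}.encard : ℕ∞) : ℝ≥0∞)

/-- `K` is the `m`-point correlation function on `U` of the random set of points `S`: the density
with respect to Lebesgue measure on `U^m` of the `m`-th factorial moment measure, which maps `B` to
the expected number of ordered `m`-tuples of distinct points of `S` that lie in `B`. -/
structure IsCorrelationFunctionOn {Ω : Type*} [MeasurableSpace Ω] (P : Measure Ω) {m : ℕ}
    (S : Ω → Set ℝ) (U : Set ℝ) (K : (Fin m → ℝ) → ℝ≥0∞) : Prop where
  aemeasurable : AEMeasurable K (volume.restrict (Set.univ.pi fun _ => U))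
  aemeasurable_count : ∀ B : Set (Fin m → ℝ), MeasurableSet B → B ⊆ (Set.univ.pi fun _ => U) →
    AEMeasurable (fun ω => tupleCount (S ω) B) P
  lintegral_count : ∀ B : Set (Fin m → ℝ), MeasurableSet B → B ⊆ (Set.univ.pi fun _ => U) →
    ∫⁻ ω, tupleCount (S ω) B ∂P = ∫⁻ y in B, K y

end

/-! Put t = tan θ and let p be the polynomial with coefficients √(n choose k) c_k. Then g_n = cosⁿθ
· p(t), so the scaled zeros are the zeros of g_n in U, and away from θ = 0 h_n is the derivative of
g_n in y. The function h_n is a nonzero factor times `derivPoly n p` evaluated at t.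

Kac's formula counts the zeros of g in an interval as the limit of (2ε)⁻¹ ∫ |g'| over {|g| < ε}. In
`kacSmooth` the factor |g'| is replaced by its local average `absAvg`, with vanishing error
(`tendsto_kacSmooth`). The average introduces variables η_i. For fixed y and η, the mean over the
coefficients of the product over the m points is |∏ η_i| times the joint law's mass of a cube about
(0, η) divided by the cube's volume (`kacMean_eq`). Integrating in the other order gives the mean of
a product of `kacSmooth` (`lintegral_kacMean`). On a box of regular tuples this tends to the
expected zero count: almost surely there are no double roots, and h_n has at most n + 1 zeros, which
gives a bound uniform in ε.

It remains to exchange the limit with the integral over (y, η), although the density of the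
coefficients is only continuous and the joint density may be unbounded. Fatou's lemma bounds the
integral of `kacLower`, which dominates the Kac-Rice integral, by the count
(`setLIntegral_kacLower_le`). Conversely, a coefficient density cut off to compact support has
images under `evalMap` that are continuous, uniformly bounded and supported in a common ball.
Dominated convergence then gives equality (`kacLower_of_compact`), and monotone convergence removes
the cutoff. The Kac-Rice integral is thus squeezed between two functions with the same finite
integral (`setLIntegral_kacRiceOf_box`). Its measurability follows too.

Nondegeneracy is Hermite interpolation (`eq_zero_of_gVal_hVal`): since 2m ≤ n + 1, values and
derivatives at m distinct points determine the first 2m coefficients. So `evalMap` is onto, the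
joint law is absolutely continuous, and differentiation of measures yields the first claim. A π-λ
argument and a cover by boxes extend the second claim from boxes to Borel sets of regular tuples;
the other tuples contribute nothing. -/

noncomputable section

/-! ### Kac's counting formula in one variable -/

/-- The integral of `|g'|` over the part of `(a, b)` where `|g| < ε`. -/
def kacIntegral (g g' : ℝ → ℝ) (a b ε : ℝ) : ℝ≥0∞ :=
  ∫⁻ y in Ioo a b, {y | |g y| < ε}.indicator (fun y => ENNReal.ofReal |g' y|) y

theorem kacIntegral_neg (g g' : ℝ → ℝ) (a b ε : ℝ) :
    kacIntegral (fun y => - g y) (fun y => - g' y) a b ε = kacIntegral g g' a b ε := by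
  simp [kacIntegral]

theorem kacIntegral_add (g g' : ℝ → ℝ) {a z b : ℝ} (haz : a < z) (hzb : z < b) (ε : ℝ) :
    kacIntegral g g' a b ε = kacIntegral g g' a z ε + kacIntegral g g' z b ε := by
  unfold kacIntegral
  rw [← Ioc_union_Ioo_eq_Ioo haz.le hzb, lintegral_union measurableSet_Ioo,
    setLIntegral_congr (Ioo_ae_eq_Ioc (a := a) (b := z))]
  exact Set.disjoint_left.2 fun x hx hx' => absurd hx.2 (not_le.2 hx'.1)

/-- Change of variables by the strictly increasing g: the part of (a, b) where |g| < ε is mapped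
bijectively onto the stated set of levels. -/
theorem kacIntegral_of_deriv_pos {g g' : ℝ → ℝ} {a b : ℝ} (hab : a < b)
    (hg : ∀ y ∈ Icc a b, HasDerivAt g (g' y) y) (hpos : ∀ y ∈ Ioo a b, 0 < g' y) (ε : ℝ) :
    kacIntegral g g' a b ε = volume (Ioo (g a) (g b) ∩ Ioo (-ε) ε) ∧ StrictMonoOn g (Icc a b) := by
  have hcont : ContinuousOn g (Icc a b) := fun y hy => (hg y hy).continuousAt.continuousWithinAt
  have hmono : StrictMonoOn g (Icc a b) := by
    refine strictMonoOn_of_deriv_pos (convex_Icc a b) hcont fun y hy => ?_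
    rw [interior_Icc] at hy
    rw [(hg y (Ioo_subset_Icc_self hy)).deriv]
    exact hpos y hy
  refine ⟨?_, hmono⟩
  have himage : g '' (Ioo a b ∩ {y | |g y| < ε}) = Ioo (g a) (g b) ∩ Ioo (-ε) ε := by
    ext t
    constructor
    · rintro ⟨y, ⟨hy, hy'⟩, rfl⟩
      exact ⟨⟨hmono (left_mem_Icc.2 hab.le) (Ioo_subset_Icc_self hy) hy.1,
        hmono (Ioo_subset_Icc_self hy) (right_mem_Icc.2 hab.le) hy.2⟩, abs_lt.1 hy'⟩
    · rintro ⟨ht, ht'⟩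
      obtain ⟨y, hy, rfl⟩ := intermediate_value_Ioo hab.le hcont ht
      exact ⟨y, ⟨hy, abs_lt.2 ht'⟩, rfl⟩
  have hopen : IsOpen (Ioo a b ∩ {y | |g y| < ε}) := by
    have : ContinuousOn (fun y => |g y|) (Ioo a b) :=
      (hcont.mono Ioo_subset_Icc_self).abs
    exact this.isOpen_inter_preimage isOpen_Ioo isOpen_Iio
  rw [← himage, ← setLIntegral_one, lintegral_image_eq_lintegral_abs_deriv_mul hopen.measurableSet
    (fun y hy => (hg y (Ioo_subset_Icc_self hy.1)).hasDerivWithinAt)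
    ((hmono.injOn.mono Ioo_subset_Icc_self).mono inter_subset_left)]
  unfold kacIntegral
  rw [← lintegral_indicator measurableSet_Ioo, ← lintegral_indicator hopen.measurableSet]
  refine lintegral_congr fun y => ?_
  rw [Set.indicator_indicator]
  simp

/-- Once ε is below |g a| and |g b|, the window (-ε, ε) lies inside the range of g if g changes
sign, and is disjoint from it otherwise. -/
theorem kacIntegral_of_deriv_pos' {g g' : ℝ → ℝ} {a b : ℝ} (hab : a < b)
    (hg : ∀ y ∈ Icc a b, HasDerivAt g (g' y) y) (hpos : ∀ y ∈ Ioo a b, 0 < g' y) :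
    (∀ ε, kacIntegral g g' a b ε ≤ ENNReal.ofReal (2 * ε)) ∧
    (g a ≠ 0 → g b ≠ 0 → ∀ᶠ ε in 𝓝[>] (0 : ℝ), kacIntegral g g' a b ε =
      ENNReal.ofReal (2 * ε) * (({y ∈ Ioo a b | g y = 0}.encard : ℕ∞) : ℝ≥0∞)) := by
  have H := kacIntegral_of_deriv_pos hab hg hpos
  have hmono := (H 0).2
  have hcont : ContinuousOn g (Icc a b) := fun y hy => (hg y hy).continuousAt.continuousWithinAt
  have hvol : ∀ ε : ℝ, volume (Ioo (-ε) ε) = ENNReal.ofReal (2 * ε) := fun ε => by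
    rw [Real.volume_Ioo]; congr 1; ring
  refine ⟨fun ε => ?_, fun ha hb => ?_⟩
  · rw [(H ε).1, ← hvol]
    exact measure_mono inter_subset_right
  · have hε : ∀ᶠ ε in 𝓝[>] (0 : ℝ), ε < |g a| ∧ ε < |g b| := by
      have : Ioo (0 : ℝ) (min |g a| |g b|) ∈ 𝓝[>] (0 : ℝ) := Ioo_mem_nhdsGT (by positivity)
      filter_upwards [this] with ε hε
      exact lt_min_iff.1 hε.2
    have hab' : g a < g b := hmono (left_mem_Icc.2 hab.le) (right_mem_Icc.2 hab.le) hab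
    filter_upwards [hε, self_mem_nhdsWithin] with ε hε hε0
    have hε0 : 0 < ε := hε0
    rw [(H ε).1]
    by_cases hs : g a < 0 ∧ 0 < g b
    · obtain ⟨z, hz, hz0⟩ := intermediate_value_Ioo hab.le hcont (show (0 : ℝ) ∈ Ioo (g a) (g b) from hs)
      have : {y ∈ Ioo a b | g y = 0} = {z} := by
        ext y
        constructor
        · rintro ⟨hy, hy0⟩
          exact hmono.injOn (Ioo_subset_Icc_self hy) (Ioo_subset_Icc_self hz) (hy0.trans hz0.symm)
        · rintro rfl
          exact ⟨hz, hz0⟩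
      rw [this, encard_singleton]
      rw [abs_of_neg hs.1, abs_of_pos hs.2] at hε
      rw [inter_eq_self_of_subset_right (Ioo_subset_Ioo (by linarith) (by linarith)), hvol]
      simp
    · have : {y ∈ Ioo a b | g y = 0} = ∅ := by
        rw [Set.eq_empty_iff_forall_notMem]
        rintro y ⟨hy, hy0⟩
        exact hs ⟨hy0 ▸ hmono (left_mem_Icc.2 hab.le) (Ioo_subset_Icc_self hy) hy.1,
          hy0 ▸ hmono (Ioo_subset_Icc_self hy) (right_mem_Icc.2 hab.le) hy.2⟩
      rw [this]
      have h2 : Ioo (g a) (g b) ∩ Ioo (-ε) ε = ∅ := by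
        rw [Set.eq_empty_iff_forall_notMem]
        rintro t ⟨ht, ht'⟩
        rcases lt_or_gt_of_ne ha with h | h
        · rw [abs_of_neg h] at hε
          have : g b < 0 := lt_of_le_of_ne (not_lt.1 fun h' => hs ⟨h, h'⟩) hb
          rw [abs_of_neg this] at hε
          linarith [ht.2, ht'.1, hε.2]
        · rw [abs_of_pos h] at hε
          linarith [ht.1, ht'.2, hε.1]
      rw [h2]
      simp

theorem kacIntegral_of_deriv_ne {g g' : ℝ → ℝ} {a b : ℝ} (hab : a < b)
    (hg : ∀ y ∈ Icc a b, HasDerivAt g (g' y) y) (hne : ∀ y ∈ Ioo a b, g' y ≠ 0) :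
    (∀ ε, kacIntegral g g' a b ε ≤ ENNReal.ofReal (2 * ε)) ∧
    (g a ≠ 0 → g b ≠ 0 → ∀ᶠ ε in 𝓝[>] (0 : ℝ), kacIntegral g g' a b ε =
      ENNReal.ofReal (2 * ε) * (({y ∈ Ioo a b | g y = 0}.encard : ℕ∞) : ℝ≥0∞)) := by
  -- Darboux: a derivative without zeros has constant sign, with no continuity of g' required.
  rcases hasDerivWithinAt_forall_lt_or_forall_gt_of_forall_ne (convex_Ioo a b)
    (fun y hy => (hg y (Ioo_subset_Icc_self hy)).hasDerivWithinAt) hne with h | h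
  · have := kacIntegral_of_deriv_pos' (g := fun y => - g y) (g' := fun y => - g' y) hab
      (fun y hy => (hg y hy).neg) (fun y hy => neg_pos.2 (h y hy))
    simpa only [kacIntegral_neg, neg_eq_zero, ne_eq] using this
  · exact kacIntegral_of_deriv_pos' hab hg h

/-- If `g'` has at most `k` zeros in `(a, b)`, then every level of `g` is crossed at most `k + 1`
times, and `(2 ε)⁻¹ ∫ |g'|` over `|g| < ε` counts the zeros of `g` for small `ε`. -/
theorem kacIntegral_of_encard_le {g g' : ℝ → ℝ} (k : ℕ) : ∀ {a b : ℝ}, a < b →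
    (∀ y ∈ Icc a b, HasDerivAt g (g' y) y) → {y ∈ Ioo a b | g' y = 0}.encard ≤ k →
    (∀ ε, kacIntegral g g' a b ε ≤ (k + 1) * ENNReal.ofReal (2 * ε)) ∧
    (g a ≠ 0 → g b ≠ 0 → (∀ y ∈ Ioo a b, g' y = 0 → g y ≠ 0) →
      ∀ᶠ ε in 𝓝[>] (0 : ℝ), kacIntegral g g' a b ε =
      ENNReal.ofReal (2 * ε) * (({y ∈ Ioo a b | g y = 0}.encard : ℕ∞) : ℝ≥0∞)) := by
  induction k using Nat.strong_induction_on with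
  | _ k ih =>
    intro a b hab hg hk
    by_cases hne : ∀ y ∈ Ioo a b, g' y ≠ 0
    · obtain ⟨h1, h2⟩ := kacIntegral_of_deriv_ne hab hg hne
      exact ⟨fun ε => (h1 ε).trans (le_mul_of_one_le_left' (by simp)), fun ha hb _ => h2 ha hb⟩
    · push Not at hne
      -- Cutting at a critical point z leaves p and q critical points on the two sides with p + q +
      -- 1 ≤ k, so the bounds (p + 1) + (q + 1) ≤ k + 1 add up.
      obtain ⟨z, hz, hz0⟩ := hne
      set A := {y ∈ Ioo a z | g' y = 0} with hA
      set B := {y ∈ Ioo z b | g' y = 0} with hB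
      have hAB : Disjoint A B := Set.disjoint_left.2 fun x hx hx' =>
        absurd (hx.1.2.trans hx'.1.1) (lt_irrefl _)
      have hzAB : z ∉ A ∪ B := by
        rintro (h | h)
        · exact lt_irrefl _ h.1.2
        · exact lt_irrefl _ h.1.1
      have hsub : insert z (A ∪ B) ⊆ {y ∈ Ioo a b | g' y = 0} := by
        rintro y (rfl | h | h)
        · exact ⟨hz, hz0⟩
        · exact ⟨⟨h.1.1, h.1.2.trans hz.2⟩, h.2⟩
        · exact ⟨⟨hz.1.trans h.1.1, h.1.2⟩, h.2⟩
      have hcard : A.encard + B.encard + 1 ≤ k := by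
        rw [← encard_union_eq hAB, ← encard_insert_of_notMem hzAB]
        exact (encard_le_encard hsub).trans hk
      have hAtop : A.encard ≠ ⊤ := by
        intro h; rw [h] at hcard; simp at hcard
      have hBtop : B.encard ≠ ⊤ := by
        intro h; rw [h] at hcard; simp at hcard
      obtain ⟨p, hp⟩ := ENat.ne_top_iff_exists.1 hAtop
      obtain ⟨q, hq⟩ := ENat.ne_top_iff_exists.1 hBtop
      rw [← hp, ← hq] at hcard
      have hpq : p + q + 1 ≤ k := by exact_mod_cast hcard
      obtain ⟨h1, h2⟩ := ih p (by omega) hz.1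
        (fun y hy => hg y ⟨hy.1, hy.2.trans hz.2.le⟩) hp.symm.le
      obtain ⟨h3, h4⟩ := ih q (by omega) hz.2
        (fun y hy => hg y ⟨hz.1.le.trans hy.1, hy.2⟩) hq.symm.le
      refine ⟨fun ε => ?_, fun ha hb hs => ?_⟩
      · rw [kacIntegral_add g g' hz.1 hz.2]
        refine (add_le_add (h1 ε) (h3 ε)).trans ?_
        rw [← add_mul]
        refine mul_le_mul' ?_ le_rfl
        calc (p : ℝ≥0∞) + 1 + (q + 1) = ((p + q + 1 : ℕ) : ℝ≥0∞) + 1 := by push_cast; ring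
          _ ≤ (k : ℝ≥0∞) + 1 := by gcongr
      -- A critical point is not a zero of g, so z is an admissible endpoint for both halves and no
      -- zero is lost at the cut.
      · have hgz : g z ≠ 0 := hs z hz hz0
        filter_upwards [h2 ha hgz fun y hy => hs y ⟨hy.1, hy.2.trans hz.2⟩,
          h4 hgz hb fun y hy => hs y ⟨hz.1.trans hy.1, hy.2⟩] with ε e1 e2
        rw [kacIntegral_add g g' hz.1 hz.2, e1, e2, ← mul_add]
        congr 1
        have : {y ∈ Ioo a b | g y = 0} = {y ∈ Ioo a z | g y = 0} ∪ {y ∈ Ioo z b | g y = 0} := by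
          ext y
          constructor
          · rintro ⟨hy, hy0⟩
            rcases lt_trichotomy y z with h | h | h
            · exact Or.inl ⟨⟨hy.1, h⟩, hy0⟩
            · exact absurd (h ▸ hy0) hgz
            · exact Or.inr ⟨⟨h, hy.2⟩, hy0⟩
          · rintro (h | h)
            · exact ⟨⟨h.1.1, h.1.2.trans hz.2⟩, h.2⟩
            · exact ⟨⟨hz.1.trans h.1.1, h.1.2⟩, h.2⟩
        rw [this, encard_union_eq]
        · simp
        · exact Set.disjoint_left.2 fun x hx hx' => absurd (hx.1.2.trans hx'.1.1) (lt_irrefl _)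

theorem indicator_le_indicator_add {α : Type*} {s : Set α} {f g : α → ℝ≥0∞} {C : ℝ≥0∞} {y : α}
    (h : y ∈ s → f y ≤ g y + C) :
    s.indicator f y ≤ s.indicator g y + s.indicator (fun _ => C) y := by
  by_cases hy : y ∈ s
  · simpa [hy] using h hy
  · simp [hy]

/-! ### Smoothing the derivative factor -/

/-- The average of `|·|` over `(h - ε, h + ε)`. -/
def absAvg (ε h : ℝ) : ℝ≥0∞ :=
  (ENNReal.ofReal (2 * ε))⁻¹ *
    ∫⁻ η : ℝ, {η | |h - η| < ε}.indicator (fun η => ENNReal.ofReal |η|) η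

theorem setOf_abs_sub_lt (h ε : ℝ) : {η : ℝ | |h - η| < ε} = Ioo (h - ε) (h + ε) := by
  ext η
  simp only [mem_ofPred_eq, abs_lt, mem_Ioo]
  constructor <;> rintro ⟨h1, h2⟩ <;> constructor <;> linarith

theorem lintegral_indicator_abs_sub_lt (h ε : ℝ) (C : ℝ≥0∞) :
    ∫⁻ η : ℝ, {η | |h - η| < ε}.indicator (fun _ => C) η = C * ENNReal.ofReal (2 * ε) := by
  rw [setOf_abs_sub_lt, lintegral_indicator measurableSet_Ioo, setLIntegral_const, Real.volume_Ioo]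
  congr 2
  ring

theorem absAvg_le {ε : ℝ} (hε : 0 < ε) (h : ℝ) :
    absAvg ε h ≤ ENNReal.ofReal |h| + ENNReal.ofReal ε := by
  have h0 : ENNReal.ofReal (2 * ε) ≠ 0 := by simpa using hε
  have h1 : ENNReal.ofReal (2 * ε) ≠ ∞ := ENNReal.ofReal_ne_top
  unfold absAvg
  rw [← ENNReal.div_eq_inv_mul, ENNReal.div_le_iff h0 h1, ← lintegral_indicator_abs_sub_lt h]
  refine lintegral_mono fun η => ?_
  refine Set.indicator_le_indicator' fun hη => ?_
  rw [← ENNReal.ofReal_add (abs_nonneg _) hε.le]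
  apply ENNReal.ofReal_le_ofReal
  have hη : |h - η| < ε := hη
  have := abs_sub_abs_le_abs_sub η h
  rw [abs_sub_comm] at this
  linarith

theorem le_absAvg_add {ε : ℝ} (hε : 0 < ε) (h : ℝ) :
    ENNReal.ofReal |h| ≤ absAvg ε h + ENNReal.ofReal ε := by
  have h0 : ENNReal.ofReal (2 * ε) ≠ 0 := by simpa using hε
  have h1 : ENNReal.ofReal (2 * ε) ≠ ∞ := ENNReal.ofReal_ne_top
  have key : ENNReal.ofReal |h| * ENNReal.ofReal (2 * ε) ≤
      (∫⁻ η : ℝ, {η | |h - η| < ε}.indicator (fun η => ENNReal.ofReal |η|) η) +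
        ENNReal.ofReal ε * ENNReal.ofReal (2 * ε) := by
    rw [← lintegral_indicator_abs_sub_lt h, ← lintegral_indicator_abs_sub_lt h,
      ← lintegral_add_right]
    · refine lintegral_mono fun η => ?_
      refine indicator_le_indicator_add fun hη => ?_
      rw [← ENNReal.ofReal_add (abs_nonneg _) hε.le]
      apply ENNReal.ofReal_le_ofReal
      have hη : |h - η| < ε := hη
      have := abs_sub_abs_le_abs_sub h η
      linarith
    · rw [setOf_abs_sub_lt]
      exact measurable_const.indicator measurableSet_Ioo
  unfold absAvg
  rw [← ENNReal.mul_le_mul_iff_left h0 h1]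
  refine key.trans (le_of_eq ?_)
  rw [add_mul, mul_comm (ENNReal.ofReal (2 * ε))⁻¹, mul_assoc, ENNReal.inv_mul_cancel h0 h1, mul_one]

/-- The integral that counts the zeros of `g` in `(a, b)` as `ε → 0`, if `h = g'`. -/
def kacSmooth (g h : ℝ → ℝ) (a b ε : ℝ) : ℝ≥0∞ :=
  ∫⁻ y in Ioo a b, (ENNReal.ofReal (2 * ε))⁻¹ *
    {y | |g y| < ε}.indicator (fun y => absAvg ε (h y)) y

theorem measurableSet_abs_lt {g : ℝ → ℝ} (hg : Measurable g) (ε : ℝ) :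
    MeasurableSet {y | |g y| < ε} :=
  measurableSet_lt hg.abs measurable_const

/-- The average differs from |h| by at most ε ≤ 2ε, and only where |g| < ε matters; the prefactor
(2ε)⁻¹ turns this into at most the measure of that set. -/
theorem kacSmooth_le_add {g h : ℝ → ℝ} (hg : Measurable g) {a b ε : ℝ} (hε : 0 < ε) :
    kacSmooth g h a b ε ≤ (ENNReal.ofReal (2 * ε))⁻¹ * kacIntegral g h a b ε +
      volume (Ioo a b ∩ {y | |g y| < ε}) := by
  have hS := measurableSet_abs_lt hg ε
  have h0 : ENNReal.ofReal (2 * ε) ≠ 0 := by simpa using hε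
  have h1 : ENNReal.ofReal (2 * ε) ≠ ∞ := ENNReal.ofReal_ne_top
  unfold kacSmooth kacIntegral
  rw [lintegral_const_mul' _ _ (ENNReal.inv_ne_top.2 h0)]
  have : ∫⁻ y in Ioo a b, {y | |g y| < ε}.indicator (fun y => absAvg ε (h y)) y ≤
      (∫⁻ y in Ioo a b, {y | |g y| < ε}.indicator (fun y => ENNReal.ofReal |h y|) y) +
      ENNReal.ofReal (2 * ε) * volume (Ioo a b ∩ {y | |g y| < ε}) := by
    rw [← inter_comm, ← Measure.restrict_apply hS, ← setLIntegral_const,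
      ← lintegral_indicator hS, ← lintegral_add_right _ (measurable_const.indicator hS)]
    refine lintegral_mono fun y => ?_
    refine indicator_le_indicator_add fun _ => (absAvg_le hε _).trans ?_
    gcongr
    linarith
  refine (mul_le_mul_right this _).trans (le_of_eq ?_)
  rw [mul_add, ← mul_assoc _ (ENNReal.ofReal (2 * ε)), ENNReal.inv_mul_cancel h0 h1, one_mul]

theorem kacIntegral_le_kacSmooth_add {g h : ℝ → ℝ} (hg : Measurable g) {a b ε : ℝ} (hε : 0 < ε) :
    (ENNReal.ofReal (2 * ε))⁻¹ * kacIntegral g h a b ε ≤ kacSmooth g h a b ε +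
      volume (Ioo a b ∩ {y | |g y| < ε}) := by
  have hS := measurableSet_abs_lt hg ε
  have h0 : ENNReal.ofReal (2 * ε) ≠ 0 := by simpa using hε
  have h1 : ENNReal.ofReal (2 * ε) ≠ ∞ := ENNReal.ofReal_ne_top
  unfold kacSmooth kacIntegral
  rw [lintegral_const_mul' _ _ (ENNReal.inv_ne_top.2 h0)]
  have : ∫⁻ y in Ioo a b, {y | |g y| < ε}.indicator (fun y => ENNReal.ofReal |h y|) y ≤
      (∫⁻ y in Ioo a b, {y | |g y| < ε}.indicator (fun y => absAvg ε (h y)) y) +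
      ENNReal.ofReal (2 * ε) * volume (Ioo a b ∩ {y | |g y| < ε}) := by
    rw [← inter_comm, ← Measure.restrict_apply hS, ← setLIntegral_const,
      ← lintegral_indicator hS, ← lintegral_add_right _ (measurable_const.indicator hS)]
    refine lintegral_mono fun y => ?_
    refine indicator_le_indicator_add fun _ => (le_absAvg_add hε _).trans ?_
    gcongr
    linarith
  refine (mul_le_mul_right this _).trans (le_of_eq ?_)
  rw [mul_add, ← mul_assoc _ (ENNReal.ofReal (2 * ε)), ENNReal.inv_mul_cancel h0 h1, one_mul]

/-- The bound does not involve ε, so it serves as the dominating constant for the limit ε → 0. -/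
theorem kacSmooth_le {g h : ℝ → ℝ} (hgm : Measurable g) {a b : ℝ} (hab : a < b)
    (hg : ∀ y ∈ Icc a b, HasDerivAt g (h y) y) {k : ℕ}
    (hk : {y ∈ Ioo a b | h y = 0}.encard ≤ k) {ε : ℝ} (hε : 0 < ε) :
    kacSmooth g h a b ε ≤ k + 1 + ENNReal.ofReal (b - a) := by
  have h0 : ENNReal.ofReal (2 * ε) ≠ 0 := by simpa using hε
  have h1 : ENNReal.ofReal (2 * ε) ≠ ∞ := ENNReal.ofReal_ne_top
  refine (kacSmooth_le_add hgm hε).trans (add_le_add ?_ ?_)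
  · rw [← ENNReal.div_eq_inv_mul, ENNReal.div_le_iff h0 h1]
    exact (kacIntegral_of_encard_le k hab hg hk).1 ε
  · rw [← Real.volume_Ioo]
    exact measure_mono inter_subset_left

/-- **Kac's counting formula.** -/
theorem tendsto_kacSmooth {g h : ℝ → ℝ} (hgm : Measurable g) {a b : ℝ} (hab : a < b)
    (hg : ∀ y ∈ Icc a b, HasDerivAt g (h y) y) {k : ℕ}
    (hk : {y ∈ Ioo a b | h y = 0}.encard ≤ k) (ha : g a ≠ 0) (hb : g b ≠ 0)
    (hs : ∀ y ∈ Ioo a b, h y = 0 → g y ≠ 0) (hfin : {y ∈ Ioo a b | g y = 0}.Finite) :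
    Tendsto (kacSmooth g h a b) (𝓝[>] 0)
      (𝓝 (({y ∈ Ioo a b | g y = 0}.encard : ℕ∞) : ℝ≥0∞)) := by
  set N : ℝ≥0∞ := (({y ∈ Ioo a b | g y = 0}.encard : ℕ∞) : ℝ≥0∞) with hN
  have hkac : ∀ᶠ ε in 𝓝[>] (0 : ℝ), (ENNReal.ofReal (2 * ε))⁻¹ * kacIntegral g h a b ε = N := by
    filter_upwards [(kacIntegral_of_encard_le k hab hg hk).2 ha hb hs, self_mem_nhdsWithin]
      with ε hε hε0
    have hε0 : 0 < ε := hε0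
    rw [hε, ← mul_assoc, ENNReal.inv_mul_cancel (by simpa using hε0) ENNReal.ofReal_ne_top, one_mul]
  -- As ε decreases to 0 the sets where |g| < ε shrink to the zeros of g, a finite and hence null
  -- set.
  have herr : Tendsto (fun ε => volume (Ioo a b ∩ {y | |g y| < ε})) (𝓝[>] (0 : ℝ)) (𝓝 0) := by
    have hz : volume (⋂ ε > (0 : ℝ), (Ioo a b ∩ {y | |g y| < ε})) = 0 := by
      refine measure_mono_null ?_ (hfin.measure_zero volume)
      intro y hy
      simp only [mem_iInter, mem_inter_iff, mem_ofPred_eq] at hy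
      refine ⟨(hy 1 one_pos).1, ?_⟩
      by_contra hne
      exact lt_irrefl _ (hy |g y| (abs_pos.2 hne)).2
    rw [← hz]
    refine tendsto_measure_biInter_gt (fun ε _ =>
      (measurableSet_Ioo.inter (measurableSet_abs_lt hgm ε)).nullMeasurableSet) ?_ ⟨1, one_pos, ?_⟩
    · intro i j _ hij y hy
      exact ⟨hy.1, lt_of_lt_of_le hy.2 hij⟩
    · exact ((measure_mono inter_subset_left).trans_lt measure_Ioo_lt_top).ne
  have hNtop : N ≠ ∞ := by
    rw [hN, hfin.encard_eq_coe_toFinset_card]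
    simp
  refine tendsto_of_tendsto_of_tendsto_of_le_of_le'
    (g := fun ε => N - volume (Ioo a b ∩ {y | |g y| < ε}))
    (h := fun ε => N + volume (Ioo a b ∩ {y | |g y| < ε})) ?_ ?_ ?_ ?_
  · simpa using ENNReal.Tendsto.sub (tendsto_const_nhds (x := N)) herr (Or.inl hNtop)
  · simpa using (tendsto_const_nhds (x := N)).add herr
  · filter_upwards [hkac, self_mem_nhdsWithin] with ε hε hε0
    rw [tsub_le_iff_right, ← hε]
    exact kacIntegral_le_kacSmooth_add hgm hε0
  · filter_upwards [hkac, self_mem_nhdsWithin] with ε hε hε0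
    rw [← hε]
    exact kacSmooth_le_add hgm hε0

/-! ### The fields as polynomials in tan θ -/

/-- The field `g_n` as a function of the coefficient vector. -/
def gVal {n : ℕ} (θ₀ : ℝ) (x : Fin (n + 1) → ℝ) (y : ℝ) : ℝ := ∑ k, weightMu n θ₀ k y * x k

/-- The field `h_n` as a function of the coefficient vector. -/
def hVal {n : ℕ} (θ₀ : ℝ) (x : Fin (n + 1) → ℝ) (y : ℝ) : ℝ := ∑ k, weightLambda n θ₀ k y * x k

/-- The polynomial with coefficients `√(n choose k) x_k`. -/
def coefPoly {n : ℕ} (x : Fin (n + 1) → ℝ) : Polynomial ℝ :=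
  ∑ k : Fin (n + 1), Polynomial.C (√((n.choose k : ℕ) : ℝ) * x k) * Polynomial.X ^ (k : ℕ)

/-- The points of the scaled range where the weights `λ_k` are regular. -/
def regularRange (n : ℕ) (θ₀ : ℝ) : Set ℝ := {y | y ∈ scaledRange n θ₀ ∧ angle n θ₀ y ≠ 0}

theorem continuous_angle (n : ℕ) (θ₀ : ℝ) : Continuous (angle n θ₀) := by
  unfold angle; fun_prop

theorem isOpen_regularRange (n : ℕ) (θ₀ : ℝ) : IsOpen (regularRange n θ₀) :=
  (isOpen_Ioo.preimage (continuous_angle n θ₀)).inter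
    (isOpen_ne.preimage (continuous_angle n θ₀))

theorem cos_angle_pos {n : ℕ} {θ₀ y : ℝ} (hy : y ∈ scaledRange n θ₀) : 0 < cos (angle n θ₀ y) :=
  cos_pos_of_mem_Ioo hy

theorem sin_angle_ne {n : ℕ} {θ₀ y : ℝ} (hy : y ∈ regularRange n θ₀) : sin (angle n θ₀ y) ≠ 0 := by
  have hπ := Real.pi_pos
  have h1 := hy.1
  simp only [scaledRange, mem_ofPred_eq, mem_Ioo] at h1
  intro h
  exact hy.2 ((sin_eq_zero_iff_of_lt_of_lt (by linarith) (by linarith)).1 h)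

theorem angle_injective {n : ℕ} (hn : n ≠ 0) (θ₀ : ℝ) : Function.Injective (angle n θ₀) := by
  intro a b h
  have : (0 : ℝ) < √(n : ℝ) := Real.sqrt_pos.2 (by positivity)
  simpa [angle, div_left_inj' this.ne'] using h

theorem tan_angle_injOn {n : ℕ} (hn : n ≠ 0) (θ₀ : ℝ) :
    InjOn (fun y => tan (angle n θ₀ y)) (scaledRange n θ₀) :=
  fun _ ha _ hb h => angle_injective hn θ₀ (injOn_tan ha hb h)

theorem weightMu_eq {n : ℕ} {θ₀ y : ℝ} (hy : y ∈ scaledRange n θ₀) (k : Fin (n + 1)) :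
    weightMu n θ₀ k y =
      cos (angle n θ₀ y) ^ n * (√((n.choose k : ℕ) : ℝ) * tan (angle n θ₀ y) ^ (k : ℕ)) := by
  have hc := (cos_angle_pos hy).ne'
  have hk : (k : ℕ) ≤ n := Nat.lt_succ_iff.1 k.2
  unfold weightMu
  have hpow : cos (angle n θ₀ y) ^ n =
      cos (angle n θ₀ y) ^ (n - (k : ℕ)) * cos (angle n θ₀ y) ^ (k : ℕ) := by
    rw [← pow_add, Nat.sub_add_cancel hk]
  rw [tan_eq_sin_div_cos, div_pow, hpow]
  field_simp

theorem gVal_eq {n : ℕ} {θ₀ y : ℝ} (hy : y ∈ scaledRange n θ₀) (x : Fin (n + 1) → ℝ) :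
    gVal θ₀ x y = cos (angle n θ₀ y) ^ n * (coefPoly x).eval (tan (angle n θ₀ y)) := by
  unfold gVal coefPoly
  rw [Polynomial.eval_finsetSum, Finset.mul_sum]
  refine Finset.sum_congr rfl fun k _ => ?_
  rw [weightMu_eq hy]
  simp
  ring

/-- `(1 + X²) p' - n X p`, whose zeros are those of `h_n`. -/
def derivPoly (n : ℕ) (p : Polynomial ℝ) : Polynomial ℝ :=
  (1 + Polynomial.X ^ 2) * Polynomial.derivative p - (n : Polynomial ℝ) * Polynomial.X * p

/-- The polynomial is what differentiation of cosⁿθ · p(tan θ) in θ produces, and 1/√n is dθ/dy. The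
identity is verified monomial by monomial from the definition of λ_k. -/
theorem hVal_eq {n : ℕ} (hn : n ≠ 0) {θ₀ y : ℝ} (hy : y ∈ regularRange n θ₀)
    (x : Fin (n + 1) → ℝ) :
    hVal θ₀ x y = cos (angle n θ₀ y) ^ n / √(n : ℝ) *
      (derivPoly n (coefPoly x)).eval (tan (angle n θ₀ y)) := by
  have hc := (cos_angle_pos hy.1).ne'
  have hs := sin_angle_ne hy
  have hn0 : (n : ℝ) ≠ 0 := by exact_mod_cast hn
  have hsq : √(n : ℝ) ≠ 0 := (Real.sqrt_pos.2 (by positivity)).ne'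
  have hsqn : √(n : ℝ) * √(n : ℝ) = n := Real.mul_self_sqrt (by positivity)
  have hsc := sin_sq_add_cos_sq (angle n θ₀ y)
  unfold hVal derivPoly coefPoly
  simp only [Polynomial.derivative_sum, Finset.mul_sum, ← Finset.sum_sub_distrib,
    Polynomial.eval_finsetSum]
  refine Finset.sum_congr rfl fun k _ => ?_
  unfold weightLambda
  rw [weightMu_eq hy.1]
  have ht : tan (angle n θ₀ y) ≠ 0 := by
    rw [tan_eq_sin_div_cos]; exact div_ne_zero hs hc
  have hpow : ((k : ℕ) : ℝ) * tan (angle n θ₀ y) ^ ((k : ℕ) - 1) =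
      (k : ℕ) * tan (angle n θ₀ y) ^ (k : ℕ) / tan (angle n θ₀ y) := by
    rcases Nat.eq_zero_or_pos (k : ℕ) with h | h
    · simp [h]
    · rw [← Nat.sub_add_cancel h, pow_add]; simp; field_simp
  simp only [Polynomial.derivative_C_mul, Polynomial.derivative_X_pow, Polynomial.eval_sub,
    Polynomial.eval_mul, Polynomial.eval_add, Polynomial.eval_one, Polynomial.eval_pow,
    Polynomial.eval_X, Polynomial.eval_C, Polynomial.eval_natCast, hpow]
  generalize tan (angle n θ₀ y) ^ (k : ℕ) = T
  rw [tan_eq_sin_div_cos]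
  generalize cos (angle n θ₀ y) ^ n = D
  generalize √((n.choose k : ℕ) : ℝ) = b
  generalize sin (angle n θ₀ y) = s at *
  generalize cos (angle n θ₀ y) = u at *
  field_simp
  have e1 : √(n : ℝ) ^ 2 = n := by rw [sq, hsqn]
  rw [e1]
  have e2 : u ^ 2 = 1 - s ^ 2 := by linarith
  have e3 : u ^ 2 + s ^ 2 = 1 := by linarith
  rw [e3]
  ring

/-- The logarithmic derivative of sin^k θ cos^(n-k) θ is k cot θ - (n - k) tan θ = (k - n
sin²θ)/(sin θ cos θ); dθ/dy = 1/√n turns this into λ_k/μ_k. -/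
theorem hasDerivAt_weightMu {n : ℕ} (hn : n ≠ 0) {θ₀ y : ℝ} (hy : y ∈ regularRange n θ₀)
    (k : Fin (n + 1)) : HasDerivAt (weightMu n θ₀ k) (weightLambda n θ₀ k y) y := by
  have hc := (cos_angle_pos hy.1).ne'
  have hs := sin_angle_ne hy
  have hn0 : (n : ℝ) ≠ 0 := by exact_mod_cast hn
  have hsq : √(n : ℝ) ≠ 0 := (Real.sqrt_pos.2 (by positivity)).ne'
  have hsqn : √(n : ℝ) ^ 2 = n := Real.sq_sqrt (by positivity)
  have hsc := sin_sq_add_cos_sq (angle n θ₀ y)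
  have hk : (k : ℕ) ≤ n := Nat.lt_succ_iff.1 k.2
  have hA : HasDerivAt (angle n θ₀) (1 / √(n : ℝ)) y := by
    unfold angle
    exact ((hasDerivAt_id y).div_const _).const_add _
  have hpow : ∀ (j : ℕ) (v : ℝ), v ≠ 0 → (j : ℝ) * v ^ (j - 1) = j * v ^ j / v := by
    intro j v hv
    rcases Nat.eq_zero_or_pos j with h | h
    · simp [h]
    · rw [eq_div_iff hv, mul_assoc, ← pow_succ, Nat.sub_add_cancel h]
  have key := ((hA.sin.pow (k : ℕ)).mul (hA.cos.pow (n - (k : ℕ)))).mul_const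
    (√((n.choose k : ℕ) : ℝ))
  refine key.congr_deriv ?_
  unfold weightLambda weightMu
  simp only [Pi.pow_apply]
  rw [hpow _ _ hs, hpow _ _ hc, Nat.cast_sub hk]
  generalize sin (angle n θ₀ y) ^ (k : ℕ) = S
  generalize cos (angle n θ₀ y) ^ (n - (k : ℕ)) = D
  generalize √((n.choose k : ℕ) : ℝ) = b
  generalize sin (angle n θ₀ y) = s at *
  generalize cos (angle n θ₀ y) = u at *
  field_simp
  rw [hsqn]
  have e2 : u ^ 2 = 1 - s ^ 2 := by linarith
  rw [e2]
  ring

theorem hasDerivAt_gVal {n : ℕ} (hn : n ≠ 0) {θ₀ y : ℝ} (hy : y ∈ regularRange n θ₀)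
    (x : Fin (n + 1) → ℝ) : HasDerivAt (gVal θ₀ x) (hVal θ₀ x y) y := by
  unfold gVal hVal
  exact HasDerivAt.fun_sum fun k _ => (hasDerivAt_weightMu hn hy k).mul_const _

theorem coeff_coefPoly {n : ℕ} (x : Fin (n + 1) → ℝ) (k : Fin (n + 1)) :
    (coefPoly x).coeff k = √((n.choose k : ℕ) : ℝ) * x k := by
  unfold coefPoly
  simp only [Polynomial.finsetSum_coeff, Polynomial.coeff_C_mul, Polynomial.coeff_X_pow]
  rw [Finset.sum_eq_single k]
  · simp
  · intro j _ hj
    rw [if_neg fun h => hj (Fin.ext h.symm), mul_zero]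
  · simp

theorem sqrt_choose_pos {n : ℕ} (k : Fin (n + 1)) : 0 < √((n.choose k : ℕ) : ℝ) :=
  Real.sqrt_pos.2 (by exact_mod_cast Nat.choose_pos (Nat.lt_succ_iff.1 k.2))

theorem coefPoly_ne_zero {n : ℕ} {x : Fin (n + 1) → ℝ} (hx : x ≠ 0) : coefPoly x ≠ 0 := by
  intro h
  refine hx (funext fun k => ?_)
  have := coeff_coefPoly x k
  rw [h, Polynomial.coeff_zero] at this
  exact (mul_eq_zero.1 this.symm).resolve_left (sqrt_choose_pos k).ne'

theorem natDegree_coefPoly_le {n : ℕ} (x : Fin (n + 1) → ℝ) : (coefPoly x).natDegree ≤ n := by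
  unfold coefPoly
  refine Polynomial.natDegree_sum_le_of_forall_le _ _ fun k _ => ?_
  exact (Polynomial.natDegree_C_mul_X_pow_le _ _).trans (Nat.lt_succ_iff.1 k.2)

theorem natDegree_derivPoly_le {n : ℕ} {p : Polynomial ℝ} (hp : p.natDegree ≤ n) :
    (derivPoly n p).natDegree ≤ n + 1 := by
  unfold derivPoly
  refine (Polynomial.natDegree_sub_le _ _).trans (max_le ?_ ?_)
  · have h1 := Polynomial.natDegree_derivative_le p
    -- Constants are treated apart: there the truncated degree bound for p' is still 0, and the
    -- product bound 2 would exceed n + 1 when n = 0.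
    by_cases h0 : p.natDegree = 0
    · rw [Polynomial.derivative_of_natDegree_zero h0]; simp
    refine Polynomial.natDegree_mul_le.trans ?_
    have : (1 + Polynomial.X ^ 2 : Polynomial ℝ).natDegree ≤ 2 := by
      compute_degree
    omega
  · refine Polynomial.natDegree_mul_le.trans ?_
    have : ((n : Polynomial ℝ) * Polynomial.X).natDegree ≤ 1 := by compute_degree
    omega

/-- At 0 the polynomial takes the value p'(0), the coefficient of X in p, which is a positive
multiple of x 1. -/
theorem derivPoly_ne_zero {n : ℕ} (hn : n ≠ 0) {x : Fin (n + 1) → ℝ} (hx : x 1 ≠ 0) :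
    derivPoly n (coefPoly x) ≠ 0 := by
  intro h
  -- The numeral 1 in `Fin (n + 1)` is the index 1 only because n ≠ 0.
  have h1 : ((1 : Fin (n + 1)) : ℕ) = 1 := by
    obtain ⟨j, rfl⟩ := Nat.exists_eq_succ_of_ne_zero hn
    simp
  have h0 := congrArg (fun q => Polynomial.eval 0 q) h
  simp only [derivPoly, Polynomial.eval_sub, Polynomial.eval_mul, Polynomial.eval_add,
    Polynomial.eval_one, Polynomial.eval_pow, Polynomial.eval_X, Polynomial.eval_zero] at h0
  have h2 : (Polynomial.derivative (coefPoly x)).eval 0 = 0 := by simpa using h0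
  rw [← Polynomial.coeff_zero_eq_eval_zero, Polynomial.coeff_derivative] at h2
  have h3 := coeff_coefPoly x 1
  rw [h1] at h3
  have := sqrt_choose_pos (1 : Fin (n + 1))
  rw [h1] at this
  simp only [zero_add, Nat.cast_zero, mul_one] at h2
  rw [h3] at h2
  exact (mul_ne_zero this.ne' hx) h2

/-- tan ∘ `angle` is injective on the scaled range, so distinct points give distinct roots of q. -/
theorem encard_le_of_isRoot {n : ℕ} (hn : n ≠ 0) (θ₀ : ℝ) {q : Polynomial ℝ} (hq : q ≠ 0)
    {s : Set ℝ} (hs : s ⊆ scaledRange n θ₀) (hroot : ∀ y ∈ s, q.IsRoot (tan (angle n θ₀ y))) :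
    s.encard ≤ q.natDegree := by
  rw [← ((tan_angle_injOn hn θ₀).mono hs).encard_image]
  have : (fun y => tan (angle n θ₀ y)) '' s ⊆ (q.roots.toFinset : Set ℝ) := by
    rintro _ ⟨y, hy, rfl⟩
    simpa [hq] using hroot y hy
  refine (encard_le_encard this).trans ?_
  rw [encard_coe_eq_coe_finsetCard]
  exact_mod_cast (Multiset.toFinset_card_le _).trans (Polynomial.card_roots' q)

theorem encard_hVal_zeros_le {n : ℕ} (hn : n ≠ 0) {θ₀ : ℝ} {x : Fin (n + 1) → ℝ} (hx : x 1 ≠ 0)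
    {s : Set ℝ} (hs : s ⊆ regularRange n θ₀) :
    {y ∈ s | hVal θ₀ x y = 0}.encard ≤ (n + 1 : ℕ) := by
  refine (encard_le_of_isRoot hn θ₀ (derivPoly_ne_zero hn hx) (fun y hy => (hs hy.1).1)
    fun y hy => ?_).trans (by exact_mod_cast natDegree_derivPoly_le (natDegree_coefPoly_le x))
  have h := hy.2
  rw [hVal_eq hn (hs hy.1)] at h
  refine (mul_eq_zero.1 h).resolve_left (div_ne_zero (pow_ne_zero _ (cos_angle_pos (hs hy.1).1).ne') ?_)
  exact (Real.sqrt_pos.2 (by positivity)).ne'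

theorem finite_gVal_zeros {n : ℕ} (hn : n ≠ 0) {θ₀ : ℝ} {x : Fin (n + 1) → ℝ} (hx : x ≠ 0) :
    {y ∈ scaledRange n θ₀ | gVal θ₀ x y = 0}.Finite := by
  refine Set.finite_of_encard_le_coe (k := (coefPoly x).natDegree)
    (encard_le_of_isRoot hn θ₀ (coefPoly_ne_zero hx) (fun y hy => hy.1) fun y hy => ?_)
  have h := hy.2
  rw [gVal_eq hy.1] at h
  exact (mul_eq_zero.1 h).resolve_left (pow_ne_zero _ (cos_angle_pos hy.1).ne')

/-- If p(t) = 0, the polynomial of h_n reduces at t to (1 + t²) p'(t), and 1 + t² never vanishes.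
Common zeros of g_n and h_n are therefore double roots. -/
theorem isRoot_of_gVal_hVal {n : ℕ} (hn : n ≠ 0) {θ₀ y : ℝ} (hy : y ∈ regularRange n θ₀)
    {x : Fin (n + 1) → ℝ} (hg : gVal θ₀ x y = 0) (hh : hVal θ₀ x y = 0) :
    (coefPoly x).IsRoot (tan (angle n θ₀ y)) ∧
      (Polynomial.derivative (coefPoly x)).IsRoot (tan (angle n θ₀ y)) := by
  have hc := (cos_angle_pos hy.1).ne'
  have hsq : √(n : ℝ) ≠ 0 := (Real.sqrt_pos.2 (by positivity)).ne'
  rw [gVal_eq hy.1] at hg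
  have h1 := (mul_eq_zero.1 hg).resolve_left (pow_ne_zero _ hc)
  refine ⟨h1, ?_⟩
  rw [hVal_eq hn hy] at hh
  have h2 := (mul_eq_zero.1 hh).resolve_left (div_ne_zero (pow_ne_zero _ hc) hsq)
  simp only [derivPoly, Polynomial.eval_sub, Polynomial.eval_mul, h1, mul_zero, sub_zero] at h2
  refine (mul_eq_zero.1 h2).resolve_left ?_
  simp only [Polynomial.eval_add, Polynomial.eval_one, Polynomial.eval_pow, Polynomial.eval_X]
  positivity

/-- Hermite interpolation in the space spanned by the first `2 m` monomials is injective. -/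
theorem eq_zero_of_gVal_hVal {n m : ℕ} (hn : n ≠ 0) {θ₀ : ℝ} {y : Fin m → ℝ}
    (hinj : Function.Injective y) (hy : ∀ i, y i ∈ regularRange n θ₀) {x : Fin (n + 1) → ℝ}
    (hx : ∀ k : Fin (n + 1), 2 * m ≤ (k : ℕ) → x k = 0)
    (hg : ∀ i, gVal θ₀ x (y i) = 0) (hh : ∀ i, hVal θ₀ x (y i) = 0) : x = 0 := by
  by_contra hx0
  have hp := coefPoly_ne_zero hx0
  set t : Fin m → ℝ := fun i => tan (angle n θ₀ (y i)) with ht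
  have htinj : Function.Injective t := fun i j hij =>
    hinj (tan_angle_injOn hn θ₀ (hy i).1 (hy j).1 hij)
  -- Each t i is a double root, and squares of distinct linear factors are coprime; so a divisor of
  -- degree 2m meets a polynomial of degree below 2m.
  have hdvd : ∏ i : Fin m, (Polynomial.X - Polynomial.C (t i)) ^ 2 ∣ coefPoly x := by
    refine Finset.prod_dvd_of_coprime ?_ ?_
    · intro i _ j _ hij
      exact (Polynomial.pairwise_coprime_X_sub_C htinj hij).pow
    · intro i _
      rw [← Polynomial.le_rootMultiplicity_iff hp]
      exact (Polynomial.one_lt_rootMultiplicity_iff_isRoot hp).2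
        (isRoot_of_gVal_hVal hn (hy i) (hg i) (hh i))
  have hdeg : (∏ i : Fin m, (Polynomial.X - Polynomial.C (t i)) ^ 2).natDegree = 2 * m := by
    rw [Polynomial.natDegree_prod_of_monic _ _ fun i _ => (Polynomial.monic_X_sub_C _).pow 2]
    simp [mul_comm]
  have hlt : (coefPoly x).degree < (2 * m : ℕ) := by
    rw [Polynomial.degree_lt_iff_coeff_zero]
    intro k hk
    by_cases hkn : k < n + 1
    · have := coeff_coefPoly x ⟨k, hkn⟩
      simp only at this
      rw [this, hx ⟨k, hkn⟩ hk, mul_zero]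
    · exact Polynomial.coeff_eq_zero_of_natDegree_lt
        (lt_of_le_of_lt (natDegree_coefPoly_le x) (by omega))
  refine hp (Polynomial.eq_zero_of_dvd_of_degree_lt hdvd ?_)
  rw [Polynomial.degree_eq_natDegree
    (Polynomial.monic_prod_of_monic _ _ fun i _ => (Polynomial.monic_X_sub_C _).pow 2).ne_zero,
    hdeg]
  exact hlt

/-! ### Regularity of the weights and almost sure nondegeneracy -/

theorem measurable_weightMu (n : ℕ) (θ₀ : ℝ) (k : Fin (n + 1)) : Measurable (weightMu n θ₀ k) := by
  unfold weightMu angle; fun_prop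

theorem measurable_weightLambda (n : ℕ) (θ₀ : ℝ) (k : Fin (n + 1)) :
    Measurable (weightLambda n θ₀ k) := by
  unfold weightLambda angle
  have := measurable_weightMu n θ₀ k
  fun_prop

theorem continuousOn_weightMu (n : ℕ) (θ₀ : ℝ) (k : Fin (n + 1)) (s : Set ℝ) :
    ContinuousOn (weightMu n θ₀ k) s := by
  unfold weightMu angle; fun_prop

theorem continuousOn_weightLambda (n : ℕ) (θ₀ : ℝ) (k : Fin (n + 1)) :
    ContinuousOn (weightLambda n θ₀ k) (regularRange n θ₀) := by
  unfold weightLambda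
  have h1 := continuousOn_weightMu n θ₀ k (regularRange n θ₀)
  have h2 := continuous_angle n θ₀
  refine ContinuousOn.div (by fun_prop) (by fun_prop) fun y hy => ?_
  exact mul_ne_zero (sin_angle_ne hy) (cos_angle_pos hy.1).ne'

theorem mem_scaledZeros_iff {Ω : Type*} {n : ℕ} (hn : n ≠ 0) (c : Fin (n + 1) → Ω → ℝ) (θ₀ : ℝ)
    (ω : Ω) (y : ℝ) : y ∈ scaledZeros c θ₀ ω ↔
      y ∈ scaledRange n θ₀ ∧ gVal θ₀ (fun k => c k ω) y = 0 := by
  have hsq : √(n : ℝ) ≠ 0 := (Real.sqrt_pos.2 (by positivity)).ne'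
  have heval : ∀ x : ℝ, randPoly c ω x = (coefPoly fun k => c k ω).eval x := by
    intro x
    simp [randPoly, coefPoly, Polynomial.eval_finsetSum]
  have hang : ∀ x : ℝ, angle n θ₀ (√(n : ℝ) * (arctan x - θ₀)) = arctan x := by
    intro x
    unfold angle
    rw [mul_div_cancel_left₀ _ hsq]
    ring
  constructor
  · rintro ⟨x, hx, rfl⟩
    have hU : √(n : ℝ) * (arctan x - θ₀) ∈ scaledRange n θ₀ := by
      simp only [scaledRange, mem_ofPred_eq, hang]
      exact arctan_mem_Ioo x
    refine ⟨hU, ?_⟩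
    rw [gVal_eq hU, hang, tan_arctan, ← heval, hx, mul_zero]
  · rintro ⟨hU, hg⟩
    refine ⟨tan (angle n θ₀ y), ?_, ?_⟩
    · rw [gVal_eq hU] at hg
      rw [heval]
      exact (mul_eq_zero.1 hg).resolve_left (pow_ne_zero _ (cos_angle_pos hU).ne')
    · rw [arctan_tan hU.1 hU.2]
      unfold angle
      rw [add_sub_cancel_left, mul_div_cancel₀ _ hsq]

/-- The exceptional set is the kernel of a linear functional, nonzero because its coefficient at x 0
is cosⁿθ > 0; a proper subspace is null. -/
theorem ae_gVal_ne_zero {n : ℕ} {θ₀ y : ℝ} (hy : y ∈ scaledRange n θ₀) :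
    ∀ᵐ x : Fin (n + 1) → ℝ, gVal θ₀ x y ≠ 0 := by
  let L : (Fin (n + 1) → ℝ) →ₗ[ℝ] ℝ := ∑ k, weightMu n θ₀ k y • LinearMap.proj k
  have hL : ∀ x, L x = gVal θ₀ x y := fun x => by simp [L, gVal]
  have hne : LinearMap.ker L ≠ ⊤ := by
    intro h
    have h1 : L (Pi.single 0 1) = 0 := by
      rw [← LinearMap.mem_ker, h]; trivial
    rw [hL] at h1
    unfold gVal at h1
    rw [Finset.sum_eq_single 0 (fun j _ hj => by simp [hj]) (by simp)] at h1
    simp [weightMu, (cos_angle_pos hy).ne'] at h1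
  have := Measure.addHaar_submodule (volume : Measure (Fin (n + 1) → ℝ)) (LinearMap.ker L) hne
  rw [ae_iff]
  refine measure_mono_null ?_ this
  intro x hx
  simpa [hL] using hx

theorem ae_eval_ne_zero {n : ℕ} (k : Fin (n + 1)) : ∀ᵐ x : Fin (n + 1) → ℝ, x k ≠ 0 :=
  Measure.ae_eval_ne (μ := fun _ : Fin (n + 1) => (volume : Measure ℝ)) k 0

theorem coefPoly_insertNth {n : ℕ} (s : ℝ) (w : Fin n → ℝ) :
    coefPoly (n := n) ((0 : Fin (n + 1)).insertNth s w) =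
      Polynomial.C s + coefPoly (n := n) ((0 : Fin (n + 1)).insertNth 0 w) := by
  unfold coefPoly
  rw [Fin.sum_univ_succ, Fin.sum_univ_succ]
  simp

theorem continuous_eval_coefPoly {n : ℕ} :
    Continuous fun z : (Fin (n + 1) → ℝ) × ℝ => (coefPoly z.1).eval z.2 := by
  unfold coefPoly
  simp only [Polynomial.eval_finsetSum, Polynomial.eval_mul, Polynomial.eval_C,
    Polynomial.eval_pow, Polynomial.eval_X]
  fun_prop

theorem continuous_eval_derivative_coefPoly {n : ℕ} :
    Continuous fun z : (Fin (n + 1) → ℝ) × ℝ =>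
      (Polynomial.derivative (coefPoly z.1)).eval z.2 := by
  unfold coefPoly
  simp only [Polynomial.derivative_sum, Polynomial.eval_finsetSum, Polynomial.derivative_C_mul,
    Polynomial.derivative_X_pow, Polynomial.eval_mul, Polynomial.eval_C,
    Polynomial.eval_pow, Polynomial.eval_X]
  fun_prop

/-- With t confined to [-N, N], the set is the projection of a closed set along a compact factor,
hence closed. Measurability is needed for the Fubini argument in `ae_no_double_root`. -/
theorem measurableSet_double_root (n : ℕ) :
    MeasurableSet {x : Fin (n + 1) → ℝ | ∃ t, (coefPoly x).IsRoot t ∧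
      (Polynomial.derivative (coefPoly x)).IsRoot t} := by
  have : {x : Fin (n + 1) → ℝ | ∃ t, (coefPoly x).IsRoot t ∧
      (Polynomial.derivative (coefPoly x)).IsRoot t} =
      ⋃ N : ℕ, Prod.fst '' {z : (Fin (n + 1) → ℝ) × Icc (-(N : ℝ)) N |
        (coefPoly z.1).eval (z.2 : ℝ) = 0 ∧
        (Polynomial.derivative (coefPoly z.1)).eval (z.2 : ℝ) = 0} := by
    ext x
    simp only [mem_ofPred_eq, mem_iUnion, mem_image, Prod.exists, exists_and_right, exists_eq_right]
    constructor
    · rintro ⟨t, h1, h2⟩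
      obtain ⟨N, hN⟩ := exists_nat_ge |t|
      exact ⟨N, ⟨t, abs_le.1 hN⟩, h1, h2⟩
    · rintro ⟨N, t, h1, h2⟩
      exact ⟨t, h1, h2⟩
  rw [this]
  refine MeasurableSet.iUnion fun N => IsClosed.measurableSet ?_
  refine isClosedMap_fst_of_compactSpace _ ?_
  have hc : Continuous fun z : (Fin (n + 1) → ℝ) × Icc (-(N : ℝ)) N => (z.1, (z.2 : ℝ)) := by
    fun_prop
  exact (isClosed_eq (continuous_eval_coefPoly.comp hc) continuous_const).inter
    (isClosed_eq (continuous_eval_derivative_coefPoly.comp hc) continuous_const)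

/-- Fubini over the constant coefficient s: with the others fixed, p = s + q, and a double root t
forces q'(t) = 0 and s = -q(t). If the linear coefficient is nonzero then q' ≠ 0, so only finitely
many s are bad. -/
theorem ae_no_double_root {n : ℕ} (hn : n ≠ 0) : ∀ᵐ x : Fin (n + 1) → ℝ,
    ¬ ∃ t, (coefPoly x).IsRoot t ∧ (Polynomial.derivative (coefPoly x)).IsRoot t := by
  obtain ⟨l, rfl⟩ := Nat.exists_eq_succ_of_ne_zero hn
  rw [ae_iff]
  simp only [not_not]
  have hmp := (volume_preserving_piFinSuccAbove (fun _ : Fin (l + 1 + 1) => ℝ) 0).symm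
  have hS := measurableSet_double_root (l + 1)
  rw [← hmp.measure_preimage hS.nullMeasurableSet]
  rw [Measure.volume_eq_prod, Measure.prod_apply_symm (hmp.measurable hS)]
  refine (lintegral_eq_zero_iff' (measurable_measure_prodMk_right (hmp.measurable hS)).aemeasurable).2 ?_
  filter_upwards [Measure.ae_eval_ne (μ := fun _ : Fin (l + 1) => (volume : Measure ℝ)) 0 0]
    with w hw
  set q := coefPoly (n := l + 1) ((0 : Fin (l + 1 + 1)).insertNth 0 w) with hq
  have hq1 : q.coeff 1 ≠ 0 := by
    have := coeff_coefPoly (n := l + 1) ((0 : Fin (l + 1 + 1)).insertNth 0 w) (Fin.succ 0)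
    rw [Fin.insertNth_zero, Fin.cons_succ] at this
    have h1 : ((Fin.succ 0 : Fin (l + 1 + 1)) : ℕ) = 1 := rfl
    rw [h1] at this
    rw [hq, Fin.insertNth_zero, this]
    refine mul_ne_zero (sqrt_choose_pos (Fin.succ 0 : Fin (l + 1 + 1))).ne' hw
  have hq' : Polynomial.derivative q ≠ 0 := by
    intro h
    have h0 := Polynomial.coeff_derivative q 0
    rw [h, Polynomial.coeff_zero] at h0
    simp at h0
    exact hq1 h0.symm
  refine measure_mono_null (t := (fun t => - q.eval t) '' ((Polynomial.derivative q).roots.toFinset : Set ℝ))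
    ?_ (((Polynomial.derivative q).roots.toFinset.finite_toSet.image _).measure_zero volume)
  rintro s ⟨t, h1, h2⟩
  have he : ((MeasurableEquiv.piFinSuccAbove (fun _ : Fin (l + 1 + 1) => ℝ) 0).symm (s, w)) =
    (0 : Fin (l + 1 + 1)).insertNth s w := rfl
  rw [he, coefPoly_insertNth] at h1 h2
  rw [Polynomial.IsRoot.def, Polynomial.eval_add, Polynomial.eval_C] at h1
  rw [Polynomial.derivative_add, Polynomial.derivative_C, zero_add] at h2
  rw [← hq] at h1 h2
  refine ⟨t, ?_, (eq_neg_of_add_eq_zero_left h1).symm⟩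
  rw [Finset.mem_coe, Multiset.mem_toFinset, Polynomial.mem_roots hq']
  exact h2

/-! ### Product measures -/

theorem lintegral_pi_prod {m : ℕ} (μ : Fin m → Measure ℝ) [∀ i, SigmaFinite (μ i)]
    (f : Fin m → ℝ → ℝ≥0∞) (hf : ∀ i, Measurable (f i)) :
    ∫⁻ x, ∏ i, f i (x i) ∂Measure.pi μ = ∏ i, ∫⁻ t, f i t ∂μ i := by
  induction m with
  | zero => simp
  | succ m ih =>
    have hmp := (measurePreserving_piFinSuccAbove μ 0).symm
    rw [← hmp.lintegral_comp_emb (MeasurableEquiv.measurableEmbedding _)]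
    simp only [MeasurableEquiv.piFinSuccAbove_symm_apply, Fin.insertNthEquiv,
      Fin.prod_univ_succ, Fin.insertNth_zero, Equiv.coe_fn_mk, Fin.cons_succ, Fin.cons_zero,
      Fin.zero_succAbove, cast_eq]
    rw [lintegral_prod_mul (f := f 0) (g := fun x : Fin m → ℝ => ∏ i : Fin m, f i.succ (x i))
      (hf 0).aemeasurable, ih (fun i => μ i.succ) (fun i => f i.succ) fun i => hf _]
    refine Measurable.aemeasurable ?_
    exact Finset.measurable_prod _ fun i _ => (hf _).comp (measurable_pi_apply i)

theorem pi_withDensity_eq {m : ℕ} {f : ℝ → ℝ≥0∞} (hf : Measurable f)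
    [SigmaFinite (volume.withDensity f)] :
    Measure.pi (fun _ : Fin m => volume.withDensity f) =
      (volume : Measure (Fin m → ℝ)).withDensity (fun x => ∏ i, f (x i)) := by
  refine Measure.pi_eq fun s hs => ?_
  rw [withDensity_apply _ (MeasurableSet.univ_pi hs), volume_pi, Measure.restrict_pi_pi,
    lintegral_pi_prod _ _ fun _ => hf]
  exact Finset.prod_congr rfl fun i _ => (withDensity_apply _ (hs i)).symm

/-! ### Densities of linear images -/

section LinearImage

variable {E Z W : Type*}
  [NormedAddCommGroup E] [NormedSpace ℝ E] [NormedAddCommGroup Z] [NormedSpace ℝ Z]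
  [NormedAddCommGroup W] [NormedSpace ℝ W] [FiniteDimensional ℝ W] [MeasureSpace W] [BorelSpace W]
  [(volume : Measure W).IsAddHaarMeasure]

/-- The density of the image under `L` of the measure with density `F`, in coordinates `Φ` such that
`L` restricts to an isomorphism `A` of the first factor. -/
def imageDensity (F : E → ℝ) (Φ : (Z × W) ≃L[ℝ] E) (L : E →L[ℝ] Z) (A : Z ≃L[ℝ] Z) (z : Z) : ℝ≥0∞ :=
  ENNReal.ofReal |(LinearMap.det (A : Z →ₗ[ℝ] Z))⁻¹| *
    ∫⁻ w : W, ENNReal.ofReal (F (Φ (A.symm (z - L (Φ (0, w))), w)))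

/-- For fixed w, the map z ↦ L (Φ (z, w)) is the affine isomorphism z ↦ A z + L (Φ (0, w)), which
contributes the constant Jacobian; Tonelli then moves the integral over w inside. -/
theorem map_withDensity_eq_imageDensity [MeasureSpace E] [BorelSpace E] [FiniteDimensional ℝ Z]
    [MeasureSpace Z] [BorelSpace Z] [(volume : Measure Z).IsAddHaarMeasure] {F : E → ℝ}
    (hF : Continuous F) (Φ : (Z × W) ≃L[ℝ] E) (hΦ : MeasurePreserving Φ volume volume)
    (L : E →L[ℝ] Z) (A : Z ≃L[ℝ] Z) (hA : ∀ z, A z = L (Φ (z, 0))) :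
    (volume.withDensity fun x => ENNReal.ofReal (F x)).map L =
      volume.withDensity (imageDensity F Φ L A) := by
  have hsplit : ∀ z w, L (Φ (z, w)) = A z + L (Φ (0, w)) := by
    intro z w
    rw [hA, ← map_add, ← map_add]
    simp
  have hdet : LinearMap.det (A : Z →ₗ[ℝ] Z) ≠ 0 := by
    exact (LinearEquiv.isUnit_det' A.toLinearEquiv).ne_zero
  have hFm : Measurable fun x => ENNReal.ofReal (F x) := hF.measurable.ennreal_ofReal
  have hH : Measurable fun p : Z × W =>
      ENNReal.ofReal (F (Φ (A.symm (p.1 - L (Φ (0, p.2))), p.2))) := by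
    refine (Continuous.measurable ?_).ennreal_ofReal
    fun_prop
  ext S hS
  rw [Measure.map_apply L.continuous.measurable hS,
    withDensity_apply _ (L.continuous.measurable hS), withDensity_apply _ hS,
    ← lintegral_indicator (L.continuous.measurable hS),
    ← hΦ.lintegral_comp_emb Φ.toHomeomorph.measurableEmbedding, Measure.volume_eq_prod]
  have hmeas : Measurable fun p : Z × W => S.indicator (fun z =>
      ENNReal.ofReal (F (Φ (A.symm (z - L (Φ (0, p.2))), p.2)))) p.1 := by
    have : (fun p : Z × W => S.indicator (fun z =>
      ENNReal.ofReal (F (Φ (A.symm (z - L (Φ (0, p.2))), p.2)))) p.1) =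
      (Prod.fst ⁻¹' S).indicator fun p : Z × W =>
        ENNReal.ofReal (F (Φ (A.symm (p.1 - L (Φ (0, p.2))), p.2))) := by
      ext p; rfl
    rw [this]
    exact hH.indicator (measurable_fst hS)
  rw [lintegral_prod_symm]
  swap
  · exact ((hFm.indicator (L.continuous.measurable hS)).comp Φ.continuous.measurable).aemeasurable
  have inner : ∀ w : W, ∫⁻ z : Z, (L ⁻¹' S).indicator (fun x => ENNReal.ofReal (F x)) (Φ (z, w)) =
      ENNReal.ofReal |(LinearMap.det (A : Z →ₗ[ℝ] Z))⁻¹| *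
      ∫⁻ z : Z, S.indicator (fun z =>
        ENNReal.ofReal (F (Φ (A.symm (z - L (Φ (0, w))), w)))) z := by
    intro w
    have hm : Measurable fun z => S.indicator (fun z =>
        ENNReal.ofReal (F (Φ (A.symm (z - L (Φ (0, w))), w)))) z :=
      hmeas.comp (measurable_id.prodMk measurable_const)
    set v := L (Φ (0, w)) with hv
    set H : Z → ℝ≥0∞ := fun z => S.indicator (fun z =>
        ENNReal.ofReal (F (Φ (A.symm (z - v), w)))) z with hH'
    have hm' : Measurable fun z => H (z + v) := hm.comp (measurable_id.add_const _)
    calc ∫⁻ z : Z, (L ⁻¹' S).indicator (fun x => ENNReal.ofReal (F x)) (Φ (z, w))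
        = ∫⁻ z : Z, H ((A : Z →ₗ[ℝ] Z) z + v) := by
          refine lintegral_congr fun z => ?_
          have e : L (Φ (z, w)) = (A : Z →ₗ[ℝ] Z) z + v := hsplit z w
          have e2 : A.symm ((A : Z →ₗ[ℝ] Z) z + v - v) = z := by
            rw [add_sub_cancel_right]; exact A.symm_apply_apply z
          by_cases h : L (Φ (z, w)) ∈ S
          · rw [hH', indicator_of_mem (show Φ (z, w) ∈ L ⁻¹' S from h)]
            beta_reduce
            rw [indicator_of_mem (e ▸ h), e2]
          · rw [hH', indicator_of_notMem (show Φ (z, w) ∉ L ⁻¹' S from h)]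
            beta_reduce
            rw [indicator_of_notMem (e ▸ h)]
      _ = ∫⁻ z : Z, H (z + v) ∂(volume.map (A : Z →ₗ[ℝ] Z)) :=
          (lintegral_map hm' A.continuous.measurable).symm
      _ = _ := by
          rw [Measure.map_linearMap_addHaar_eq_smul_addHaar _ hdet, lintegral_smul_measure,
            lintegral_add_right_eq_self H v, smul_eq_mul]
  simp_rw [inner]
  rw [lintegral_const_mul' _ _ ENNReal.ofReal_ne_top]
  rw [lintegral_lintegral_swap (f := fun w z => S.indicator (fun z =>
    ENNReal.ofReal (F (Φ (A.symm (z - L (Φ (0, w))), w)))) z)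
    (hmeas.comp measurable_swap).aemeasurable]
  have hH1 : Measurable fun z : Z => ∫⁻ w : W,
      ENNReal.ofReal (F (Φ (A.symm (z - L (Φ (0, w))), w))) := hH.lintegral_prod_right'
  unfold imageDensity
  rw [lintegral_const_mul _ hH1, ← lintegral_indicator hS]
  congr 1
  refine lintegral_congr fun z => ?_
  by_cases hz : z ∈ S <;> simp [hz]

/-- Compact support of F confines w to one ball for all z, so dominated convergence applies. The
bound depends on L and A only through det A, hence can be made uniform in y later. -/
theorem continuous_imageDensity {F : E → ℝ} (hF : Continuous F) {M R : ℝ}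
    (hM : ∀ x, F x ≤ M) (hR : ∀ x, F x ≠ 0 → ‖x‖ ≤ R) (Φ : (Z × W) ≃L[ℝ] E) (L : E →L[ℝ] Z)
    (A : Z ≃L[ℝ] Z) : Continuous (imageDensity F Φ L A) ∧
      ∀ z, imageDensity F Φ L A z ≤ ENNReal.ofReal |(LinearMap.det (A : Z →ₗ[ℝ] Z))⁻¹| *
        (ENNReal.ofReal M * volume (Metric.closedBall (0 : W) (‖(Φ.symm : E →L[ℝ] Z × W)‖ * R))) := by
  set K := Metric.closedBall (0 : W) (‖(Φ.symm : E →L[ℝ] Z × W)‖ * R) with hK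
  have hKm : MeasurableSet K := Metric.isClosed_closedBall.measurableSet
  have hbound : ∀ (z : Z) (w : W), ENNReal.ofReal (F (Φ (z, w))) ≤
      K.indicator (fun _ => ENNReal.ofReal M) w := by
    intro z w
    by_cases hw : w ∈ K
    · rw [indicator_of_mem hw]
      exact ENNReal.ofReal_le_ofReal (hM _)
    · rw [indicator_of_notMem hw, nonpos_iff_eq_zero]
      have : F (Φ (z, w)) = 0 := by
        by_contra h
        apply hw
        rw [hK, mem_closedBall_zero_iff]
        calc ‖w‖ ≤ ‖((z, w) : Z × W)‖ := le_max_right _ _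
          _ = ‖(Φ.symm : E →L[ℝ] Z × W) (Φ (z, w))‖ := by simp
          _ ≤ ‖(Φ.symm : E →L[ℝ] Z × W)‖ * ‖Φ (z, w)‖ := ContinuousLinearMap.le_opNorm _ _
          _ ≤ _ := by gcongr; exact hR _ h
      simp [this]
  have hint : ∫⁻ w : W, K.indicator (fun _ => ENNReal.ofReal M) w = ENNReal.ofReal M * volume K := by
    rw [lintegral_indicator hKm, setLIntegral_const]
  have hfin : ENNReal.ofReal M * volume K ≠ ∞ :=
    ENNReal.mul_ne_top ENNReal.ofReal_ne_top measure_closedBall_lt_top.ne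
  constructor
  · unfold imageDensity
    refine (ENNReal.continuous_const_mul ENNReal.ofReal_ne_top).comp ?_
    rw [continuous_iff_continuousAt]
    intro z
    refine tendsto_lintegral_filter_of_dominated_convergence
      (K.indicator fun _ => ENNReal.ofReal M) ?_ ?_ ?_ ?_
    · refine Eventually.of_forall fun z => (Continuous.measurable ?_).ennreal_ofReal
      fun_prop
    · exact Eventually.of_forall fun z => ae_of_all _ fun w => hbound _ w
    · rw [hint]; exact hfin
    · refine ae_of_all _ fun w => ?_
      have : Continuous fun z : Z => ENNReal.ofReal (F (Φ (A.symm (z - L (Φ (0, w))), w))) := by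
        refine ENNReal.continuous_ofReal.comp ?_
        fun_prop
      exact this.tendsto z
  · intro z
    unfold imageDensity
    gcongr
    rw [← hint]
    exact lintegral_mono fun w => hbound _ w

end LinearImage

/-! ### The evaluation map and its nondegeneracy -/

/-- The index equivalence that splits off the first `2 m` coefficients. -/
def indexEquiv {n m k : ℕ} (h : m + m + k = n + 1) : (Fin m ⊕ Fin m) ⊕ Fin k ≃ Fin (n + 1) :=
  ((Equiv.sumCongr finSumFinEquiv (Equiv.refl _)).trans finSumFinEquiv).trans (finCongr h)

/-- The coordinates that split off the first `2 m` coefficients. -/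
def splitCoord {n m k : ℕ} (h : m + m + k = n + 1) :
    (((Fin m → ℝ) × (Fin m → ℝ)) × (Fin k → ℝ)) ≃L[ℝ] (Fin (n + 1) → ℝ) :=
  LinearEquiv.toContinuousLinearEquiv <|
    (((LinearEquiv.sumArrowLequivProdArrow (Fin m) (Fin m) ℝ ℝ).symm.prodCongr
      (LinearEquiv.refl ℝ _)).trans
      (LinearEquiv.sumArrowLequivProdArrow (Fin m ⊕ Fin m) (Fin k) ℝ ℝ).symm).trans
      (LinearEquiv.funCongrLeft ℝ ℝ (indexEquiv h).symm)

theorem splitCoord_apply {n m k : ℕ} (h : m + m + k = n + 1)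
    (z : ((Fin m → ℝ) × (Fin m → ℝ)) × (Fin k → ℝ)) (j : Fin (n + 1)) :
    splitCoord h z j = Sum.elim (Sum.elim z.1.1 z.1.2) z.2 ((indexEquiv h).symm j) := rfl

theorem splitCoord_apply_zero {n m k : ℕ} (h : m + m + k = n + 1)
    (z : (Fin m → ℝ) × (Fin m → ℝ)) (j : Fin (n + 1)) (hj : 2 * m ≤ (j : ℕ)) :
    splitCoord h (z, 0) j = 0 := by
  rw [splitCoord_apply]
  obtain ⟨i, rfl⟩ := (indexEquiv h).surjective j
  rw [Equiv.symm_apply_apply]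
  rcases i with i | i
  · exfalso
    have : ((indexEquiv h (Sum.inl i) : Fin (n + 1)) : ℕ) = (finSumFinEquiv i : Fin (m + m)) := by
      simp [indexEquiv]
    rw [this] at hj
    have := (finSumFinEquiv i : Fin (m + m)).2
    omega
  · simp

theorem measurePreserving_splitCoord {n m k : ℕ} (h : m + m + k = n + 1) :
    MeasurePreserving (splitCoord h) volume volume := by
  have h1 := (volume_measurePreserving_sumPiEquivProdPi_symm (fun _ : Fin m ⊕ Fin m => ℝ)).prod
    (MeasurePreserving.id (volume : Measure (Fin k → ℝ)))
  have h2 := volume_measurePreserving_sumPiEquivProdPi_symm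
    (fun _ : (Fin m ⊕ Fin m) ⊕ Fin k => ℝ)
  have h3 := volume_preserving_arrowCongr' (indexEquiv h) (MeasurableEquiv.refl ℝ)
    (MeasurePreserving.id volume)
  convert! h3.comp (h2.comp h1) using 1

/-- The linear map from the coefficients to the values of `g_n` and `h_n` at `y_1, …, y_m`. -/
def evalMap {n m : ℕ} (θ₀ : ℝ) (y : Fin m → ℝ) :
    (Fin (n + 1) → ℝ) →L[ℝ] (Fin m → ℝ) × (Fin m → ℝ) :=
  LinearMap.toContinuousLinearMap
    { toFun := fun x => (fun i => gVal θ₀ x (y i), fun i => hVal θ₀ x (y i))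
      map_add' := fun a b => by
        ext i <;> simp [gVal, hVal, mul_add, Finset.sum_add_distrib]
      map_smul' := fun r a => by
        ext i <;> simp [gVal, hVal, Finset.mul_sum, mul_left_comm] }

theorem evalMap_apply {n m : ℕ} (θ₀ : ℝ) (y : Fin m → ℝ) (x : Fin (n + 1) → ℝ) :
    evalMap θ₀ y x = (fun i => gVal θ₀ x (y i), fun i => hVal θ₀ x (y i)) := rfl

/-- The tuples of distinct points at which the weights are regular. -/
def regularTuples (n m : ℕ) (θ₀ : ℝ) : Set (Fin m → ℝ) :=
  {y | Function.Injective y ∧ ∀ i, y i ∈ regularRange n θ₀}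

/-- The restriction of `evalMap` to the first `2 m` coefficients. -/
def evalSquare {n m k : ℕ} (h : m + m + k = n + 1) (θ₀ : ℝ) (y : Fin m → ℝ) :
    (Fin m → ℝ) × (Fin m → ℝ) →L[ℝ] (Fin m → ℝ) × (Fin m → ℝ) :=
  (evalMap θ₀ y).comp ((splitCoord h : _ →L[ℝ] (Fin (n + 1) → ℝ)).comp
    (ContinuousLinearMap.inl ℝ ((Fin m → ℝ) × (Fin m → ℝ)) (Fin k → ℝ)))

theorem evalSquare_apply {n m k : ℕ} (h : m + m + k = n + 1) (θ₀ : ℝ) (y : Fin m → ℝ)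
    (z : (Fin m → ℝ) × (Fin m → ℝ)) :
    evalSquare h θ₀ y z = evalMap θ₀ y (splitCoord h (z, 0)) := rfl

/-- A kernel vector gives a polynomial of degree below 2m with m distinct double roots, so it
vanishes by `eq_zero_of_gVal_hVal`. -/
theorem det_evalSquare_ne_zero {n m k : ℕ} (hn : n ≠ 0) (h : m + m + k = n + 1) {θ₀ : ℝ}
    {y : Fin m → ℝ} (hy : y ∈ regularTuples n m θ₀) : (evalSquare h θ₀ y).det ≠ 0 := by
  have hinj : Function.Injective (evalSquare h θ₀ y) := by
    rw [injective_iff_map_eq_zero]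
    intro z hz
    rw [evalSquare_apply, evalMap_apply, Prod.mk_eq_zero] at hz
    have h0 := eq_zero_of_gVal_hVal hn hy.1 hy.2 (splitCoord_apply_zero h z)
      (fun i => congrFun hz.1 i) (fun i => congrFun hz.2 i)
    have := (splitCoord h).injective (h0.trans (map_zero (splitCoord h)).symm)
    exact (Prod.mk_eq_zero.1 this).1
  intro hdet
  have hbot := LinearMap.bot_lt_ker_of_det_eq_zero
    (f := (evalSquare h θ₀ y).toLinearMap) hdet
  obtain ⟨z, hz, hz0⟩ := Submodule.exists_mem_ne_zero_of_ne_bot hbot.ne'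
  exact hz0 (hinj ((LinearMap.mem_ker.1 hz).trans (map_zero (evalSquare h θ₀ y)).symm))

theorem continuousOn_evalMap (n m : ℕ) (θ₀ : ℝ) :
    ContinuousOn (fun y => evalMap (n := n) (m := m) θ₀ y) (regularTuples n m θ₀) := by
  rw [continuousOn_clm_apply]
  intro x
  simp only [evalMap_apply]
  refine ContinuousOn.prodMk (continuousOn_pi.2 fun i => ?_) (continuousOn_pi.2 fun i => ?_)
  · unfold gVal
    refine continuousOn_finsetSum _ fun k _ => ContinuousOn.mul ?_ continuousOn_const
    exact (continuousOn_weightMu n θ₀ k (regularRange n θ₀)).comp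
      (continuous_apply i).continuousOn fun y hy => hy.2 i
  · unfold hVal
    refine continuousOn_finsetSum _ fun k _ => ContinuousOn.mul ?_ continuousOn_const
    exact (continuousOn_weightLambda n θ₀ k).comp
      (continuous_apply i).continuousOn fun y hy => hy.2 i

theorem surjective_evalMap {n m : ℕ} (hn : n ≠ 0) (hmn : 2 * m ≤ n + 1) {θ₀ : ℝ}
    {y : Fin m → ℝ} (hy : y ∈ regularTuples n m θ₀) :
    Function.Surjective (evalMap (n := n) θ₀ y) := by
  have h : m + m + (n + 1 - 2 * m) = n + 1 := by omega
  have hdet := det_evalSquare_ne_zero hn h hy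
  intro z
  refine ⟨splitCoord h (((evalSquare h θ₀ y).toContinuousLinearEquivOfDetNeZero hdet).symm z, 0), ?_⟩
  rw [← evalSquare_apply, ← ContinuousLinearMap.toContinuousLinearEquivOfDetNeZero_apply _ hdet]
  simp

instance isAddHaarMeasure_volume_prod_pi (m : ℕ) :
    (volume : Measure ((Fin m → ℝ) × (Fin m → ℝ))).IsAddHaarMeasure :=
  Measure.prod.instIsAddHaarMeasure volume volume

/-- On a compact set of regular tuples, the images of a measure with continuous compactly supported
density have continuous densities that are uniformly bounded and supported in a common ball. -/
theorem exists_image_density {n m : ℕ} (hn : n ≠ 0) (hmn : 2 * m ≤ n + 1) {θ₀ : ℝ}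
    {F : (Fin (n + 1) → ℝ) → ℝ} (hF : Continuous F) (hcpt : HasCompactSupport F)
    {Q : Set (Fin m → ℝ)} (hQ : IsCompact Q) (hQs : Q ⊆ regularTuples n m θ₀) :
    ∃ (C : ℝ≥0∞) (M : ℝ), C ≠ ∞ ∧ ∀ y ∈ Q,
      (∀ x, F x ≠ 0 → ‖evalMap θ₀ y x‖ ≤ M) ∧
      ∃ ψ : (Fin m → ℝ) × (Fin m → ℝ) → ℝ≥0∞, Continuous ψ ∧ (∀ z, ψ z ≤ C) ∧
        (volume.withDensity fun x => ENNReal.ofReal (F x)).map (evalMap θ₀ y) =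
          volume.withDensity ψ := by
  rcases Q.eq_empty_or_nonempty with rfl | hne
  · exact ⟨0, 0, by simp, by simp⟩
  have h : m + m + (n + 1 - 2 * m) = n + 1 := by omega
  obtain ⟨B, hB⟩ := hF.bounded_above_of_compact_support hcpt
  obtain ⟨R, hR⟩ := hcpt.isCompact.isBounded.exists_norm_le
  have hR' : ∀ x, F x ≠ 0 → ‖x‖ ≤ R := fun x hx => hR x (subset_tsupport _ hx)
  have hcont := (continuousOn_evalMap n m θ₀).mono hQs
  obtain ⟨N, hN⟩ := hQ.exists_bound_of_continuousOn hcont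
  have hdetc : ContinuousOn (fun y => (evalSquare (n := n) h θ₀ y).det) Q := by
    refine ContinuousLinearMap.continuous_det.comp_continuousOn ?_
    unfold evalSquare
    exact hcont.clm_comp continuousOn_const
  have hdetc' : ContinuousOn (fun y => |((evalSquare (n := n) h θ₀ y).det)⁻¹|) Q :=
    (hdetc.inv₀ fun y hy => det_evalSquare_ne_zero hn h (hQs hy)).abs
  obtain ⟨D, hD⟩ := hQ.exists_bound_of_continuousOn hdetc'
  -- This is the bound of `continuous_imageDensity` with the inverse determinant replaced by its
  -- bound D on Q; the support radius is the operator norm bound N times R.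
  refine ⟨ENNReal.ofReal D * (ENNReal.ofReal B * volume (Metric.closedBall
    (0 : Fin (n + 1 - 2 * m) → ℝ) (‖((splitCoord h).symm : (Fin (n + 1) → ℝ) →L[ℝ]
      ((Fin m → ℝ) × (Fin m → ℝ)) × (Fin (n + 1 - 2 * m) → ℝ))‖ * R))), N * R, ?_, ?_⟩
  · exact ENNReal.mul_ne_top ENNReal.ofReal_ne_top
      (ENNReal.mul_ne_top ENNReal.ofReal_ne_top measure_closedBall_lt_top.ne)
  · intro y hy
    have hdet := det_evalSquare_ne_zero hn h (hQs hy)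
    refine ⟨fun x hx => ?_, ?_⟩
    · refine ((evalMap θ₀ y).le_opNorm x).trans ?_
      exact mul_le_mul (hN y hy) (hR' x hx) (norm_nonneg _) ((norm_nonneg _).trans (hN y hy))
    · set A := (evalSquare h θ₀ y).toContinuousLinearEquivOfDetNeZero hdet with hA
      have hAdet : LinearMap.det (A : _ →ₗ[ℝ] (Fin m → ℝ) × (Fin m → ℝ)) =
          (evalSquare h θ₀ y).det := rfl
      obtain ⟨h1, h2⟩ := continuous_imageDensity hF (fun x => (le_abs_self _).trans (hB x)) hR'
        (splitCoord h) (evalMap θ₀ y) A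
      refine ⟨_, h1, fun z => (h2 z).trans ?_, map_withDensity_eq_imageDensity hF (splitCoord h)
        (measurePreserving_splitCoord h) _ A fun z => ?_⟩
      · rw [hAdet]
        gcongr
        exact (le_abs_self _).trans (hD y hy)
      · rw [hA, ContinuousLinearMap.toContinuousLinearEquivOfDetNeZero_apply, evalSquare_apply]

/-! ### The Kac-Rice integrand at scale ε -/

theorem measurable_gVal {n : ℕ} (θ₀ : ℝ) :
    Measurable fun p : (Fin (n + 1) → ℝ) × ℝ => gVal θ₀ p.1 p.2 := by
  unfold gVal
  refine Finset.measurable_fun_sum _ fun k _ => ?_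
  exact ((measurable_weightMu n θ₀ k).comp measurable_snd).mul
    ((measurable_pi_apply k).comp measurable_fst)

theorem measurable_hVal {n : ℕ} (θ₀ : ℝ) :
    Measurable fun p : (Fin (n + 1) → ℝ) × ℝ => hVal θ₀ p.1 p.2 := by
  unfold hVal
  refine Finset.measurable_fun_sum _ fun k _ => ?_
  exact ((measurable_weightLambda n θ₀ k).comp measurable_snd).mul
    ((measurable_pi_apply k).comp measurable_fst)

/-- The factor of the Kac-Rice integrand that belongs to one point. -/
def kacFactor {n : ℕ} (θ₀ ε : ℝ) (x : Fin (n + 1) → ℝ) (t s : ℝ) : ℝ≥0∞ :=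
  (ENNReal.ofReal (2 * ε))⁻¹ * {t | |gVal θ₀ x t| < ε}.indicator (fun t =>
    (ENNReal.ofReal (2 * ε))⁻¹ *
      {s | |hVal θ₀ x t - s| < ε}.indicator (fun s => ENNReal.ofReal |s|) s) t

/-- The nested form suits integration in s, which produces `absAvg`; this single indicator suits
joint measurability and the comparison with a cube. -/
theorem kacFactor_eq {n : ℕ} (θ₀ ε : ℝ) (x : Fin (n + 1) → ℝ) (t s : ℝ) :
    kacFactor θ₀ ε x t s = (ENNReal.ofReal (2 * ε))⁻¹ * (ENNReal.ofReal (2 * ε))⁻¹ *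
      {p : (Fin (n + 1) → ℝ) × ℝ × ℝ | |gVal θ₀ p.1 p.2.1| < ε ∧
        |hVal θ₀ p.1 p.2.1 - p.2.2| < ε}.indicator (fun p => ENNReal.ofReal |p.2.2|) (x, t, s) := by
  unfold kacFactor
  by_cases h1 : |gVal θ₀ x t| < ε <;> by_cases h2 : |hVal θ₀ x t - s| < ε <;>
    simp [h1, h2, mul_assoc]

theorem _root_.Measurable.gVal {α : Type*} [MeasurableSpace α] {n : ℕ} (θ₀ : ℝ)
    {u : α → Fin (n + 1) → ℝ} {v : α → ℝ} (hu : Measurable u) (hv : Measurable v) :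
    Measurable fun p => gVal θ₀ (u p) (v p) := by
  have := (measurable_gVal θ₀).comp (hu.prodMk hv)
  exact this

theorem _root_.Measurable.hVal {α : Type*} [MeasurableSpace α] {n : ℕ} (θ₀ : ℝ)
    {u : α → Fin (n + 1) → ℝ} {v : α → ℝ} (hu : Measurable u) (hv : Measurable v) :
    Measurable fun p => hVal θ₀ (u p) (v p) := by
  have := (measurable_hVal θ₀).comp (hu.prodMk hv)
  exact this

theorem measurable_kacFactor {α : Type*} [MeasurableSpace α] {n : ℕ} (θ₀ ε : ℝ)
    {u : α → Fin (n + 1) → ℝ} {v w : α → ℝ} (hu : Measurable u) (hv : Measurable v)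
    (hw : Measurable w) : Measurable fun p => kacFactor θ₀ ε (u p) (v p) (w p) := by
  have hS : MeasurableSet {p | |gVal θ₀ (u p) (v p)| < ε ∧ |hVal θ₀ (u p) (v p) - w p| < ε} :=
    (measurableSet_lt (Measurable.gVal θ₀ hu hv).abs measurable_const).inter
      (measurableSet_lt ((Measurable.hVal θ₀ hu hv).sub hw).abs measurable_const)
  have := (hw.abs.ennreal_ofReal.indicator hS).const_mul
    ((ENNReal.ofReal (2 * ε))⁻¹ * (ENNReal.ofReal (2 * ε))⁻¹)
  convert! this using 2 with p
  rw [kacFactor_eq]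
  rfl

theorem lintegral_kacFactor {n : ℕ} {θ₀ ε : ℝ} (x : Fin (n + 1) → ℝ) (t : ℝ) (hε : 0 < ε) :
    ∫⁻ s, kacFactor θ₀ ε x t s = (ENNReal.ofReal (2 * ε))⁻¹ *
    {y | |gVal θ₀ x y| < ε}.indicator (fun y => absAvg ε (hVal θ₀ x y)) t := by
  have h0 : ENNReal.ofReal (2 * ε) ≠ 0 := by simpa using hε
  unfold kacFactor
  rw [lintegral_const_mul' _ _ (ENNReal.inv_ne_top.2 h0)]
  congr 1
  by_cases h1 : |gVal θ₀ x t| < ε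
  · simp only [mem_ofPred_eq, h1, indicator_of_mem]
    rw [lintegral_const_mul' _ _ (ENNReal.inv_ne_top.2 h0)]
    rfl
  · simp [h1]

/-- The Kac-Rice integrand at scale `ε`, integrated over the coefficients. -/
def kacMean {n m : ℕ} (θ₀ ε : ℝ) (μ : Measure (Fin (n + 1) → ℝ))
    (p : (Fin m → ℝ) × (Fin m → ℝ)) : ℝ≥0∞ :=
  ∫⁻ x, ∏ i, kacFactor θ₀ ε x (p.1 i) (p.2 i) ∂μ

theorem measurable_prod_kacFactor {n m : ℕ} (θ₀ ε : ℝ) :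
    Measurable fun q : ((Fin m → ℝ) × (Fin m → ℝ)) × (Fin (n + 1) → ℝ) =>
      ∏ i, kacFactor θ₀ ε q.2 (q.1.1 i) (q.1.2 i) := by
  refine Finset.measurable_fun_prod _ fun i _ => measurable_kacFactor θ₀ ε ?_ ?_ ?_ <;> fun_prop

theorem measurable_kacMean {n m : ℕ} (θ₀ ε : ℝ) (μ : Measure (Fin (n + 1) → ℝ)) [SFinite μ] :
    Measurable (kacMean (m := m) θ₀ ε μ) :=
  (measurable_prod_kacFactor θ₀ ε).lintegral_prod_right'

theorem volume_ball_prod_pi {m : ℕ} (z : (Fin m → ℝ) × (Fin m → ℝ)) {ε : ℝ} (hε : 0 < ε) :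
    volume (Metric.ball z ε) = ENNReal.ofReal (2 * ε) ^ m * ENNReal.ofReal (2 * ε) ^ m := by
  obtain ⟨a, b⟩ := z
  rw [← ball_prod_same, Measure.volume_eq_prod, Measure.prod_prod, Real.volume_pi_ball _ hε,
    Real.volume_pi_ball _ hε, ENNReal.ofReal_pow (by positivity), Fintype.card_fin]

/-- Balls of the sup metric are cubes, so the m pairs of conditions in the product of the
`kacFactor`s say exactly that the evaluation vector lies in one ball. -/
theorem mem_ball_zero_prod_iff {m : ℕ} {ε : ℝ} (hε : 0 < ε) (u v η : Fin m → ℝ) :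
    (u, v) ∈ Metric.ball ((0 : Fin m → ℝ), η) ε ↔ ∀ i, |u i| < ε ∧ |v i - η i| < ε := by
  rw [← ball_prod_same, mem_prod, Metric.mem_ball, Metric.mem_ball, dist_pi_lt_iff hε,
    dist_pi_lt_iff hε, forall_and]
  simp [Real.dist_eq]

/-- `kacMean` is the weighted average of the joint law over a cube. -/
theorem kacMean_eq {n m : ℕ} {θ₀ ε : ℝ} (hε : 0 < ε) (μ : Measure (Fin (n + 1) → ℝ))
    (y η : Fin m → ℝ) : kacMean θ₀ ε μ (y, η) = ENNReal.ofReal |∏ i, η i| *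
      (μ.map (evalMap θ₀ y) (Metric.ball (0, η) ε) / volume (Metric.ball
        ((0 : Fin m → ℝ), η) ε)) := by
  have h0 : ENNReal.ofReal (2 * ε) ≠ 0 := by simpa using hε
  have h1 : ENNReal.ofReal (2 * ε) ≠ ∞ := ENNReal.ofReal_ne_top
  have hS : MeasurableSet ((evalMap (n := n) θ₀ y) ⁻¹' (Metric.ball (0, η) ε)) :=
    (evalMap θ₀ y).continuous.measurable Metric.isOpen_ball.measurableSet
  have hpt : ∀ x : Fin (n + 1) → ℝ, ∏ i, kacFactor θ₀ ε x (y i) (η i) =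
      ENNReal.ofReal |∏ i, η i| * (ENNReal.ofReal (2 * ε) ^ m * ENNReal.ofReal (2 * ε) ^ m)⁻¹ *
      ((evalMap θ₀ y) ⁻¹' (Metric.ball (0, η) ε)).indicator 1 x := by
    intro x
    by_cases hx : x ∈ (evalMap θ₀ y) ⁻¹' (Metric.ball (0, η) ε)
    · rw [indicator_of_mem hx]
      rw [mem_preimage, evalMap_apply, mem_ball_zero_prod_iff hε] at hx
      have : ∀ i, kacFactor θ₀ ε x (y i) (η i) = (ENNReal.ofReal (2 * ε))⁻¹ *
          (ENNReal.ofReal (2 * ε))⁻¹ * ENNReal.ofReal |η i| := by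
        intro i
        rw [kacFactor_eq, indicator_of_mem]
        exact hx i
      simp only [this]
      rw [Finset.prod_mul_distrib, Finset.abs_prod, ENNReal.ofReal_prod_of_nonneg
        fun i _ => abs_nonneg _, Finset.prod_const, Finset.card_univ, Fintype.card_fin, mul_pow,
        ← ENNReal.inv_pow, ENNReal.mul_inv (Or.inr (ENNReal.pow_ne_top h1))
        (Or.inl (ENNReal.pow_ne_top h1)), Pi.one_apply, mul_one, mul_comm]
    · rw [indicator_of_notMem hx, mul_zero]
      rw [mem_preimage, evalMap_apply, mem_ball_zero_prod_iff hε, not_forall] at hx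
      obtain ⟨i, hi⟩ := hx
      refine Finset.prod_eq_zero (Finset.mem_univ i) ?_
      rw [kacFactor_eq, indicator_of_notMem, mul_zero]
      exact hi
  unfold kacMean
  simp only [hpt]
  rw [lintegral_const_mul _ (measurable_one.indicator hS), lintegral_indicator_one hS,
    Measure.map_apply (evalMap θ₀ y).continuous.measurable Metric.isOpen_ball.measurableSet,
    volume_ball_prod_pi _ hε, ENNReal.div_eq_inv_mul, mul_assoc]

theorem measurable_kacFactor_apply {n : ℕ} (θ₀ ε : ℝ) (x : Fin (n + 1) → ℝ) (t : ℝ) :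
    Measurable (kacFactor θ₀ ε x t) :=
  measurable_kacFactor θ₀ ε measurable_const measurable_const measurable_id

/-- By Tonelli the coefficients can be integrated last. For fixed x the integrand is a product of
functions of the separate pairs (y_i, η_i), so the integral factorizes over the points. -/
theorem lintegral_kacMean {n m : ℕ} {θ₀ ε : ℝ} (hε : 0 < ε) (μ : Measure (Fin (n + 1) → ℝ))
    [SFinite μ] (a b : Fin m → ℝ) :
    ∫⁻ p, kacMean θ₀ ε μ p ∂((volume.restrict (univ.pi fun i => Ioo (a i) (b i))).prod volume) =
      ∫⁻ x, ∏ i, kacSmooth (gVal θ₀ x) (hVal θ₀ x) (a i) (b i) ε ∂μ := by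
  unfold kacMean
  have hunc : Measurable (Function.uncurry fun (p : (Fin m → ℝ) × (Fin m → ℝ))
      (x : Fin (n + 1) → ℝ) => ∏ i, kacFactor θ₀ ε x (p.1 i) (p.2 i)) := by
    rw [Function.uncurry_def]
    exact measurable_prod_kacFactor θ₀ ε
  rw [lintegral_lintegral_swap hunc.aemeasurable]
  refine lintegral_congr fun x => ?_
  have hm : Measurable fun p : (Fin m → ℝ) × (Fin m → ℝ) =>
      ∏ i, kacFactor θ₀ ε x (p.1 i) (p.2 i) := by
    refine Finset.measurable_fun_prod _ fun i _ => measurable_kacFactor θ₀ ε ?_ ?_ ?_ <;> fun_prop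
  rw [lintegral_prod _ hm.aemeasurable]
  simp only
  have hin : ∀ y : Fin m → ℝ, ∫⁻ η : Fin m → ℝ, ∏ i, kacFactor θ₀ ε x (y i) (η i) =
      ∏ i, ∫⁻ s, kacFactor θ₀ ε x (y i) s := fun y => by
    rw [volume_pi, lintegral_pi_prod (fun _ => volume) (fun i => kacFactor θ₀ ε x (y i))
      fun i => measurable_kacFactor_apply θ₀ ε x _]
  simp only [hin]
  have hm2 : Measurable fun t => ∫⁻ s, kacFactor θ₀ ε x t s :=
    Measurable.lintegral_prod_right' (f := fun p : ℝ × ℝ => kacFactor θ₀ ε x p.1 p.2)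
      (measurable_kacFactor θ₀ ε measurable_const measurable_fst measurable_snd)
  rw [volume_pi, Measure.restrict_pi_pi, lintegral_pi_prod _
    (fun _ t => ∫⁻ s, kacFactor θ₀ ε x t s) fun _ => hm2]
  refine Finset.prod_congr rfl fun i _ => ?_
  unfold kacSmooth
  exact lintegral_congr fun t => lintegral_kacFactor x t hε

/-! ### Limit of the smoothed counts on a box -/

/-- The number of zero tuples in the box `∏ (a_i, b_i)`. -/
def zeroCount {n m : ℕ} (θ₀ : ℝ) (a b : Fin m → ℝ) (x : Fin (n + 1) → ℝ) : ℝ≥0∞ :=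
  ∏ i, (({t ∈ Ioo (a i) (b i) | gVal θ₀ x t = 0}.encard : ℕ∞) : ℝ≥0∞)

/-- A sequence of scales that tends to zero. -/
def scale (j : ℕ) : ℝ := 1 / ((j : ℝ) + 1)

theorem scale_pos (j : ℕ) : 0 < scale j := by unfold scale; positivity

theorem scale_le_one (j : ℕ) : scale j ≤ 1 := by
  unfold scale
  rw [div_le_one (by positivity)]
  linarith [(Nat.cast_nonneg j : (0 : ℝ) ≤ j)]

theorem tendsto_scale : Tendsto scale atTop (𝓝[>] 0) :=
  tendsto_nhdsWithin_iff.2 ⟨tendsto_one_div_add_atTop_nhds_zero_nat,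
    Eventually.of_forall fun j => scale_pos j⟩

theorem Icc_subset_regularRange {n m : ℕ} {θ₀ : ℝ} {a b : Fin m → ℝ} (hab : ∀ i, a i < b i)
    (h : (univ.pi fun i => Icc (a i) (b i)) ⊆ regularTuples n m θ₀) (i : Fin m) :
    Icc (a i) (b i) ⊆ regularRange n θ₀ := by
  intro t ht
  -- The remaining coordinates stay at the corner a, which belongs to the box.
  have hmem : Function.update a i t ∈ univ.pi fun i => Icc (a i) (b i) := by
    intro j _
    by_cases hj : j = i
    · subst hj; simpa using ht
    · simpa [hj] using (hab j).le
  simpa using (h hmem).2 i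

theorem measurable_gVal_apply {n : ℕ} (θ₀ : ℝ) (x : Fin (n + 1) → ℝ) : Measurable (gVal θ₀ x) :=
  Measurable.gVal θ₀ measurable_const measurable_id

/-- Outside a null set of coefficients all hypotheses of Kac's formula hold: x 1 ≠ 0 bounds the
zeros of h_n, there is no double root, and no endpoint is a zero of g_n. -/
theorem ae_tendsto_prod_kacSmooth {n m : ℕ} (hn : n ≠ 0) {θ₀ : ℝ} {a b : Fin m → ℝ}
    (hab : ∀ i, a i < b i) (h : (univ.pi fun i => Icc (a i) (b i)) ⊆ regularTuples n m θ₀) :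
    ∀ᵐ x : Fin (n + 1) → ℝ,
      (∀ j, ∏ i, kacSmooth (gVal θ₀ x) (hVal θ₀ x) (a i) (b i) (scale j) ≤
        ∏ i, (((n + 1 : ℕ) : ℝ≥0∞) + 1 + ENNReal.ofReal (b i - a i))) ∧
      Tendsto (fun j => ∏ i, kacSmooth (gVal θ₀ x) (hVal θ₀ x) (a i) (b i) (scale j)) atTop
        (𝓝 (zeroCount θ₀ a b x)) := by
  have hI := Icc_subset_regularRange hab h
  filter_upwards [ae_eval_ne_zero (n := n) 1, ae_no_double_root hn,
    ae_all_iff.2 fun i => ae_gVal_ne_zero (n := n) (hI i (left_mem_Icc.2 (hab i).le)).1,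
    ae_all_iff.2 fun i => ae_gVal_ne_zero (n := n) (hI i (right_mem_Icc.2 (hab i).le)).1]
    with x h1 h2 h3 h4
  have hx : x ≠ 0 := fun h => h1 (by rw [h]; rfl)
  have hg : ∀ i, ∀ y ∈ Icc (a i) (b i), HasDerivAt (gVal θ₀ x) (hVal θ₀ x y) y :=
    fun i y hy => hasDerivAt_gVal hn (hI i hy) x
  have hk : ∀ i, {y ∈ Ioo (a i) (b i) | hVal θ₀ x y = 0}.encard ≤ (n + 1 : ℕ) :=
    fun i => encard_hVal_zeros_le hn h1 (Ioo_subset_Icc_self.trans (hI i))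
  have hfin : ∀ i, {y ∈ Ioo (a i) (b i) | gVal θ₀ x y = 0}.Finite := fun i =>
    (finite_gVal_zeros hn (θ₀ := θ₀) hx).subset fun y hy =>
      ⟨(hI i (Ioo_subset_Icc_self hy.1)).1, hy.2⟩
  refine ⟨fun j => Finset.prod_le_prod' fun i _ =>
    kacSmooth_le (measurable_gVal_apply θ₀ x) (hab i) (hg i) (hk i) (scale_pos j), ?_⟩
  refine ENNReal.tendsto_finsetProd_of_ne_top _ (fun i _ => ?_) fun i _ => ?_
  · refine (tendsto_kacSmooth (measurable_gVal_apply θ₀ x) (hab i) (hg i) (hk i) (h3 i) (h4 i)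
      (fun y hy hh hg0 => h2 ⟨_, isRoot_of_gVal_hVal hn (hI i (Ioo_subset_Icc_self hy)) hg0 hh⟩)
      (hfin i)).comp tendsto_scale
  · rw [(hfin i).encard_eq_coe_toFinset_card]
    simp

theorem measurable_absAvg (ε : ℝ) : Measurable (absAvg ε) := by
  unfold absAvg
  refine Measurable.const_mul ?_ _
  refine Measurable.lintegral_prod_right' (f := fun p : ℝ × ℝ =>
    {η : ℝ | |p.1 - η| < ε}.indicator (fun η => ENNReal.ofReal |η|) p.2) ?_
  have hS : MeasurableSet {p : ℝ × ℝ | |p.1 - p.2| < ε} :=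
    measurableSet_lt (by fun_prop) measurable_const
  exact (measurable_snd.abs.ennreal_ofReal).indicator hS

theorem measurable_kacSmooth {n : ℕ} (θ₀ ε a b : ℝ) :
    Measurable fun x : Fin (n + 1) → ℝ => kacSmooth (gVal θ₀ x) (hVal θ₀ x) a b ε := by
  unfold kacSmooth
  refine Measurable.lintegral_prod_right' (f := fun p : (Fin (n + 1) → ℝ) × ℝ =>
    (ENNReal.ofReal (2 * ε))⁻¹ * {y | |gVal θ₀ p.1 y| < ε}.indicator
      (fun y => absAvg ε (hVal θ₀ p.1 y)) p.2) ?_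
  refine Measurable.const_mul ?_ _
  have hS : MeasurableSet {p : (Fin (n + 1) → ℝ) × ℝ | |gVal θ₀ p.1 p.2| < ε} :=
    measurableSet_lt (measurable_gVal θ₀).abs measurable_const
  exact ((measurable_absAvg ε).comp (measurable_hVal θ₀)).indicator hS

theorem measurable_prod_kacSmooth {n m : ℕ} (θ₀ ε : ℝ) (a b : Fin m → ℝ) :
    Measurable fun x : Fin (n + 1) → ℝ =>
      ∏ i, kacSmooth (gVal θ₀ x) (hVal θ₀ x) (a i) (b i) ε :=
  Finset.measurable_fun_prod _ fun i _ => measurable_kacSmooth θ₀ ε (a i) (b i)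

theorem aemeasurable_zeroCount {n m : ℕ} (hn : n ≠ 0) {θ₀ : ℝ} {a b : Fin m → ℝ}
    (hab : ∀ i, a i < b i) (h : (univ.pi fun i => Icc (a i) (b i)) ⊆ regularTuples n m θ₀) :
    AEMeasurable (zeroCount (n := n) θ₀ a b) := by
  refine aemeasurable_of_tendsto_metrizable_ae atTop
    (fun j => (measurable_prod_kacSmooth (n := n) θ₀ (scale j) a b).aemeasurable) ?_
  filter_upwards [ae_tendsto_prod_kacSmooth hn hab h] with x hx using hx.2

theorem prod_bound_ne_top {m : ℕ} (n : ℕ) (a b : Fin m → ℝ) :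
    ∏ i, (((n + 1 : ℕ) : ℝ≥0∞) + 1 + ENNReal.ofReal (b i - a i)) ≠ ∞ := by
  refine ENNReal.prod_ne_top fun i _ => ?_
  simp

theorem tendsto_lintegral_prod_kacSmooth {n m : ℕ} (hn : n ≠ 0) {θ₀ : ℝ} {a b : Fin m → ℝ}
    (hab : ∀ i, a i < b i) (h : (univ.pi fun i => Icc (a i) (b i)) ⊆ regularTuples n m θ₀)
    (μ : Measure (Fin (n + 1) → ℝ)) [IsFiniteMeasure μ] (hμ : μ ≪ volume) :
    Tendsto (fun j => ∫⁻ x, ∏ i, kacSmooth (gVal θ₀ x) (hVal θ₀ x) (a i) (b i) (scale j) ∂μ) atTop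
      (𝓝 (∫⁻ x, zeroCount θ₀ a b x ∂μ)) := by
  have hae := hμ.ae_le (ae_tendsto_prod_kacSmooth hn hab h)
  refine tendsto_lintegral_of_dominated_convergence
    (fun _ => ∏ i, (((n + 1 : ℕ) : ℝ≥0∞) + 1 + ENNReal.ofReal (b i - a i)))
    (fun j => measurable_prod_kacSmooth θ₀ (scale j) a b) (fun j => ?_) ?_ ?_
  · filter_upwards [hae] with x hx using hx.1 j
  · rw [lintegral_const]
    exact ENNReal.mul_ne_top (prod_bound_ne_top n a b) (measure_ne_top _ _)
  · filter_upwards [hae] with x hx using hx.2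

theorem lintegral_zeroCount_ne_top {n m : ℕ} (hn : n ≠ 0) {θ₀ : ℝ} {a b : Fin m → ℝ}
    (hab : ∀ i, a i < b i) (h : (univ.pi fun i => Icc (a i) (b i)) ⊆ regularTuples n m θ₀)
    (μ : Measure (Fin (n + 1) → ℝ)) [IsFiniteMeasure μ] (hμ : μ ≪ volume) :
    ∫⁻ x, zeroCount θ₀ a b x ∂μ ≠ ∞ := by
  have hle : ∫⁻ x, zeroCount θ₀ a b x ∂μ ≤
      ∫⁻ _, ∏ i, (((n + 1 : ℕ) : ℝ≥0∞) + 1 + ENNReal.ofReal (b i - a i)) ∂μ := by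
    refine lintegral_mono_ae ?_
    filter_upwards [hμ.ae_le (ae_tendsto_prod_kacSmooth hn hab h)] with x hx
    exact le_of_tendsto' hx.2 hx.1
  refine ne_top_of_le_ne_top ?_ hle
  rw [lintegral_const]
  exact ENNReal.mul_ne_top (prod_bound_ne_top n a b) (measure_ne_top _ _)

/-! ### Fatou upper bound, and equality for compactly supported densities -/

theorem tendsto_withDensity_ball_div {E : Type*} [PseudoMetricSpace E] [ProperSpace E]
    [MeasureSpace E] [OpensMeasurableSpace E] [(volume : Measure E).IsOpenPosMeasure]
    [IsFiniteMeasureOnCompacts (volume : Measure E)] {f : E → ℝ≥0∞} {z : E}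
    (hf : ContinuousAt f z) :
    Tendsto (fun ε : ℝ => volume.withDensity f (Metric.ball z ε) / volume (Metric.ball z ε))
      (𝓝[>] 0) (𝓝 (f z)) := by
  have hpos : ∀ ε : ℝ, 0 < ε → volume (Metric.ball z ε) ≠ 0 := fun ε hε =>
    (Metric.measure_ball_pos volume z hε).ne'
  have hfin : ∀ ε : ℝ, volume (Metric.ball z ε) ≠ ∞ := fun ε => measure_ball_lt_top.ne
  rw [tendsto_order]
  refine ⟨fun a ha => ?_, fun b hb => ?_⟩
  · obtain ⟨a', ha', ha''⟩ := exists_between ha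
    obtain ⟨δ, hδ, hball⟩ := Metric.eventually_nhds_iff_ball.1 (hf.eventually (lt_mem_nhds ha''))
    filter_upwards [Ioo_mem_nhdsGT hδ] with ε hε
    refine ha'.trans_le ?_
    rw [ENNReal.le_div_iff_mul_le (Or.inl (hpos ε hε.1)) (Or.inl (hfin ε)),
      withDensity_apply _ Metric.isOpen_ball.measurableSet, ← setLIntegral_const]
    exact setLIntegral_mono' Metric.isOpen_ball.measurableSet
      fun x hx => (hball x (Metric.ball_subset_ball hε.2.le hx)).le
  · obtain ⟨b', hb', hb''⟩ := exists_between hb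
    obtain ⟨δ, hδ, hball⟩ := Metric.eventually_nhds_iff_ball.1 (hf.eventually (gt_mem_nhds hb'))
    filter_upwards [Ioo_mem_nhdsGT hδ] with ε hε
    refine lt_of_le_of_lt ?_ hb''
    rw [ENNReal.div_le_iff_le_mul (Or.inl (hpos ε hε.1)) (Or.inl (hfin ε)),
      withDensity_apply _ Metric.isOpen_ball.measurableSet, ← setLIntegral_const]
    exact setLIntegral_mono' Metric.isOpen_ball.measurableSet
      fun x hx => (hball x (Metric.ball_subset_ball hε.2.le hx)).le

/-- The Kac-Rice integral of the law `μ` of the coefficients. -/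
def kacRiceOf {n m : ℕ} (θ₀ : ℝ) (μ : Measure (Fin (n + 1) → ℝ)) (y : Fin m → ℝ) : ℝ≥0∞ :=
  ∫⁻ η : Fin m → ℝ, ENNReal.ofReal |∏ i, η i| * pointDensity (μ.map (evalMap θ₀ y)) (0, η)

/-- The lower limit of `kacMean` along the scales, integrated over the derivatives. -/
def kacLower {n m : ℕ} (θ₀ : ℝ) (μ : Measure (Fin (n + 1) → ℝ)) (y : Fin m → ℝ) : ℝ≥0∞ :=
  ∫⁻ η : Fin m → ℝ, liminf (fun j => kacMean θ₀ (scale j) μ (y, η)) atTop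

theorem measurable_liminf_kacMean {n m : ℕ} (θ₀ : ℝ) (μ : Measure (Fin (n + 1) → ℝ)) [SFinite μ] :
    Measurable fun p : (Fin m → ℝ) × (Fin m → ℝ) =>
      liminf (fun j => kacMean θ₀ (scale j) μ p) atTop :=
  Measurable.liminf fun j => measurable_kacMean θ₀ (scale j) μ

/-- Passing to a sequence of scales makes the lower limit measurable in (y, η), which is not evident
for the limit over all ε > 0. -/
theorem measurable_kacLower {n m : ℕ} (θ₀ : ℝ) (μ : Measure (Fin (n + 1) → ℝ)) [SFinite μ] :
    Measurable (kacLower (m := m) θ₀ μ) :=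
  (measurable_liminf_kacMean θ₀ μ).lintegral_prod_right'

/-- The lower limit over all ε → 0⁺ is at most the one along the sequence of scales. -/
theorem mul_pointDensity_le {n m : ℕ} (θ₀ : ℝ) (μ : Measure (Fin (n + 1) → ℝ)) (y η : Fin m → ℝ) :
    ENNReal.ofReal |∏ i, η i| * pointDensity (μ.map (evalMap θ₀ y)) (0, η) ≤
      liminf (fun j => kacMean θ₀ (scale j) μ (y, η)) atTop := by
  simp only [kacMean_eq (scale_pos _)]
  rw [ENNReal.liminf_const_mul_of_ne_top ENNReal.ofReal_ne_top]
  gcongr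
  unfold pointDensity
  have := liminf_le_liminf_of_le (f := 𝓝[>] (0 : ℝ)) (g := map scale atTop) tendsto_scale
    (u := fun ε : ℝ => (μ.map (evalMap θ₀ y)) (Metric.ball (0, η) ε) /
      volume (Metric.ball ((0 : Fin m → ℝ), η) ε))
  exact this

theorem kacRiceOf_le_kacLower {n m : ℕ} (θ₀ : ℝ) (μ : Measure (Fin (n + 1) → ℝ)) (y : Fin m → ℝ) :
    kacRiceOf θ₀ μ y ≤ kacLower θ₀ μ y :=
  lintegral_mono fun η => mul_pointDensity_le θ₀ μ y η

theorem setLIntegral_kacLower {n m : ℕ} (θ₀ : ℝ) (μ : Measure (Fin (n + 1) → ℝ)) [SFinite μ]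
    (Q : Set (Fin m → ℝ)) : ∫⁻ y in Q, kacLower θ₀ μ y =
      ∫⁻ p, liminf (fun j => kacMean θ₀ (scale j) μ p) atTop ∂((volume.restrict Q).prod volume) := by
  rw [lintegral_prod _ (measurable_liminf_kacMean θ₀ μ).aemeasurable]
  rfl

/-- Fatou's lemma in (y, η); the integrals at scale ε are expected smoothed counts, which converge.
-/
theorem setLIntegral_kacLower_le {n m : ℕ} (hn : n ≠ 0) {θ₀ : ℝ} {a b : Fin m → ℝ}
    (hab : ∀ i, a i < b i) (h : (univ.pi fun i => Icc (a i) (b i)) ⊆ regularTuples n m θ₀)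
    (μ : Measure (Fin (n + 1) → ℝ)) [IsFiniteMeasure μ] (hμ : μ ≪ volume) :
    ∫⁻ y in univ.pi fun i => Ioo (a i) (b i), kacLower θ₀ μ y ≤ ∫⁻ x, zeroCount θ₀ a b x ∂μ := by
  rw [setLIntegral_kacLower]
  refine (lintegral_liminf_le fun j => measurable_kacMean θ₀ (scale j) μ).trans (le_of_eq ?_)
  simp only [lintegral_kacMean (scale_pos _)]
  exact (tendsto_lintegral_prod_kacSmooth hn hab h μ hμ).liminf_eq

theorem tendsto_kacMean_of_continuous_density {n m : ℕ} {θ₀ : ℝ} {μ : Measure (Fin (n + 1) → ℝ)}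
    {y : Fin m → ℝ} {ψ : (Fin m → ℝ) × (Fin m → ℝ) → ℝ≥0∞} (hψ : Continuous ψ)
    (hμ : μ.map (evalMap θ₀ y) = volume.withDensity ψ) (η : Fin m → ℝ) :
    Tendsto (fun j => kacMean θ₀ (scale j) μ (y, η)) atTop
      (𝓝 (ENNReal.ofReal |∏ i, η i| * pointDensity (μ.map (evalMap θ₀ y)) (0, η))) := by
  have ht := tendsto_withDensity_ball_div (z := ((0 : Fin m → ℝ), η)) hψ.continuousAt
  have hp : pointDensity (μ.map (evalMap θ₀ y)) (0, η) = ψ (0, η) := by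
    rw [hμ]
    exact ht.liminf_eq
  simp only [kacMean_eq (scale_pos _)]
  refine ENNReal.Tendsto.const_mul ?_ (Or.inr ENNReal.ofReal_ne_top)
  rw [hp, hμ]
  exact ht.comp tendsto_scale

theorem pointDensity_mono {E : Type*} [PseudoMetricSpace E] [MeasureSpace E] {μ ν : Measure E}
    (h : μ ≤ ν) (z : E) : pointDensity μ z ≤ pointDensity ν z := by
  unfold pointDensity
  refine liminf_le_liminf (Eventually.of_forall fun ε => ?_)
  exact ENNReal.div_le_div_right (h _) _

/-- The ratio of masses is an average of ψ, hence at most C. If ‖η‖ > M + 1, a ball of radius ε ≤ 1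
about (0, η) misses the image of the support, so the mean is 0. -/
theorem kacMean_le_indicator {n m : ℕ} {θ₀ ε : ℝ} (hε : 0 < ε) (hε1 : ε ≤ 1)
    {F : (Fin (n + 1) → ℝ) → ℝ} {y : Fin m → ℝ} {M : ℝ} {C : ℝ≥0∞}
    (hM : ∀ x, F x ≠ 0 → ‖evalMap θ₀ y x‖ ≤ M)
    {ψ : (Fin m → ℝ) × (Fin m → ℝ) → ℝ≥0∞} (hψ : ∀ z, ψ z ≤ C)
    (hF : (volume.withDensity fun x => ENNReal.ofReal (F x)).map (evalMap θ₀ y) =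
      volume.withDensity ψ) (η : Fin m → ℝ) :
    kacMean θ₀ ε (volume.withDensity fun x => ENNReal.ofReal (F x)) (y, η) ≤
      (Metric.closedBall (0 : Fin m → ℝ) (M + 1)).indicator
        (fun _ => ENNReal.ofReal ((M + 1) ^ m) * C) η := by
  have hb : MeasurableSet (Metric.ball ((0 : Fin m → ℝ), η) ε) := Metric.isOpen_ball.measurableSet
  rw [kacMean_eq hε]
  by_cases hη : η ∈ Metric.closedBall (0 : Fin m → ℝ) (M + 1)
  · rw [indicator_of_mem hη]
    rw [mem_closedBall_zero_iff] at hη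
    refine mul_le_mul' (ENNReal.ofReal_le_ofReal ?_) ?_
    · rw [Finset.abs_prod]
      calc ∏ i, |η i| ≤ ∏ _i : Fin m, (M + 1) := by
            refine Finset.prod_le_prod (fun i _ => abs_nonneg _) fun i _ => ?_
            exact (norm_le_pi_norm η i).trans hη
        _ = (M + 1) ^ m := by simp
    · refine ENNReal.div_le_of_le_mul ?_
      rw [hF, withDensity_apply _ hb, ← setLIntegral_const]
      exact lintegral_mono fun z => hψ z
  · rw [indicator_of_notMem hη, nonpos_iff_eq_zero]
    rw [mem_closedBall_zero_iff, not_le] at hη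
    have hzero : (volume.withDensity fun x => ENNReal.ofReal (F x)).map (evalMap θ₀ y)
        (Metric.ball ((0 : Fin m → ℝ), η) ε) = 0 := by
      have hm := (evalMap (n := n) θ₀ y).continuous.measurable
      rw [Measure.map_apply hm hb, withDensity_apply _ (hm hb)]
      rw [setLIntegral_congr_fun (g := fun _ => 0) (hm hb) ?_, lintegral_zero]
      intro x hx
      by_contra h0
      have h0 : F x ≠ 0 := fun h => h0 (by simp [h])
      have hx : dist (evalMap θ₀ y x) ((0 : Fin m → ℝ), η) < ε := hx
      have h1 := hM x h0
      have h2 : ‖((0 : Fin m → ℝ), η)‖ ≤ ‖evalMap θ₀ y x‖ +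
          dist (evalMap θ₀ y x) ((0 : Fin m → ℝ), η) := by
        rw [dist_comm, dist_eq_norm]
        exact norm_le_insert' _ _
      have h3 : ‖η‖ ≤ ‖((0 : Fin m → ℝ), η)‖ := le_max_right _ _
      linarith
    rw [hzero, ENNReal.zero_div, mul_zero]

theorem isFiniteMeasure_withDensity_of_compact {n : ℕ} {F : (Fin (n + 1) → ℝ) → ℝ}
    (hF : Continuous F) (hcpt : HasCompactSupport F) :
    IsFiniteMeasure ((volume : Measure (Fin (n + 1) → ℝ)).withDensity
      fun x => ENNReal.ofReal (F x)) :=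
  isFiniteMeasure_withDensity_ofReal (hF.integrable_of_hasCompactSupport hcpt).2

/-- For compactly supported F the cube averages converge to a continuous density under one
integrable bound, so nothing is lost in Fatou's lemma. The comparison with a larger ν is
monotonicity of `pointDensity`; it prepares the removal of the cutoff. -/
theorem kacLower_of_compact {n m : ℕ} (hn : n ≠ 0) (hmn : 2 * m ≤ n + 1) {θ₀ : ℝ}
    {a b : Fin m → ℝ}
    (hab : ∀ i, a i < b i) (h : (univ.pi fun i => Icc (a i) (b i)) ⊆ regularTuples n m θ₀)
    {F : (Fin (n + 1) → ℝ) → ℝ} (hF : Continuous F) (hcpt : HasCompactSupport F)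
    {ν : Measure (Fin (n + 1) → ℝ)} (hν : (volume.withDensity fun x => ENNReal.ofReal (F x)) ≤ ν) :
    (∀ y ∈ univ.pi fun i => Ioo (a i) (b i),
      kacLower θ₀ (volume.withDensity fun x => ENNReal.ofReal (F x)) y ≤ kacRiceOf θ₀ ν y) ∧
    ∫⁻ y in univ.pi fun i => Ioo (a i) (b i),
      kacLower θ₀ (volume.withDensity fun x => ENNReal.ofReal (F x)) y =
        ∫⁻ x, zeroCount θ₀ a b x ∂(volume.withDensity fun x => ENNReal.ofReal (F x)) := by
  have hfin := isFiniteMeasure_withDensity_of_compact hF hcpt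
  set μ := (volume : Measure (Fin (n + 1) → ℝ)).withDensity fun x => ENNReal.ofReal (F x) with hμ
  set Q : Set (Fin m → ℝ) := univ.pi fun i => Ioo (a i) (b i) with hQ
  have hQc : IsCompact (univ.pi fun i => Icc (a i) (b i)) := isCompact_univ_pi fun i => isCompact_Icc
  have hQs : Q ⊆ univ.pi fun i => Icc (a i) (b i) := Set.pi_mono fun i _ => Ioo_subset_Icc_self
  have hQm : MeasurableSet Q := MeasurableSet.univ_pi fun i => measurableSet_Ioo
  have hQfin : volume Q ≠ ∞ := ((measure_mono hQs).trans_lt hQc.measure_lt_top).ne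
  obtain ⟨C, M, hC, hden⟩ := exists_image_density hn hmn hF hcpt hQc h
  have hlim : ∀ y ∈ Q, ∀ η, Tendsto (fun j => kacMean θ₀ (scale j) μ (y, η)) atTop
      (𝓝 (ENNReal.ofReal |∏ i, η i| * pointDensity (μ.map (evalMap θ₀ y)) (0, η))) := by
    intro y hy η
    obtain ⟨-, ψ, hψ, -, hmap⟩ := hden y (hQs hy)
    exact tendsto_kacMean_of_continuous_density hψ hmap η
  constructor
  · intro y hy
    refine lintegral_mono fun η => ?_
    rw [(hlim y hy η).liminf_eq]
    gcongr
    refine pointDensity_mono (Measure.map_mono hν (evalMap θ₀ y).continuous.measurable) _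
  · rw [setLIntegral_kacLower]
    have htend : Tendsto (fun j => ∫⁻ p, kacMean θ₀ (scale j) μ p
        ∂((volume.restrict Q).prod volume)) atTop
        (𝓝 (∫⁻ p, liminf (fun j => kacMean θ₀ (scale j) μ p) atTop
          ∂((volume.restrict Q).prod volume))) := by
      have hmem : ∀ᵐ p ∂((volume.restrict Q).prod (volume : Measure (Fin m → ℝ))), p.1 ∈ Q :=
        Measure.quasiMeasurePreserving_fst.ae (ae_restrict_mem hQm)
      refine tendsto_lintegral_of_dominated_convergence
        ((univ ×ˢ Metric.closedBall (0 : Fin m → ℝ) (M + 1)).indicator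
          fun _ => ENNReal.ofReal ((M + 1) ^ m) * C)
        (fun j => measurable_kacMean θ₀ (scale j) μ) (fun j => ?_) ?_ ?_
      · filter_upwards [hmem] with p hp
        obtain ⟨hM, ψ, -, hψ, hmap⟩ := hden p.1 (hQs hp)
        refine (kacMean_le_indicator (scale_pos j) (scale_le_one j) hM hψ hmap p.2).trans
          (le_of_eq ?_)
        by_cases hp2 : p.2 ∈ Metric.closedBall (0 : Fin m → ℝ) (M + 1)
        · rw [indicator_of_mem hp2, indicator_of_mem (by exact ⟨mem_univ _, hp2⟩)]
        · rw [indicator_of_notMem hp2, indicator_of_notMem fun h => hp2 h.2]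
      · rw [lintegral_indicator (MeasurableSet.univ.prod Metric.isClosed_closedBall.measurableSet),
          setLIntegral_const, Measure.prod_prod, Measure.restrict_apply_univ]
        exact ENNReal.mul_ne_top (ENNReal.mul_ne_top ENNReal.ofReal_ne_top hC)
          (ENNReal.mul_ne_top hQfin measure_closedBall_lt_top.ne)
      · filter_upwards [hmem] with p hp
        rw [(hlim p.1 hp p.2).liminf_eq]
        exact hlim p.1 hp p.2
    refine tendsto_nhds_unique htend ?_
    simp only [hQ, lintegral_kacMean (scale_pos _)]
    exact tendsto_lintegral_prod_kacSmooth hn hab h μ (withDensity_absolutelyContinuous _ _)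

/-! ### Removing the cutoff: the formula on a box -/

/-- A continuous cutoff function. -/
def cutoff {E : Type*} [NormedAddCommGroup E] (R : ℕ) (x : E) : ℝ := max 0 (min 1 ((R : ℝ) + 1 - ‖x‖))

section Cutoff

variable {E : Type*} [NormedAddCommGroup E]

theorem continuous_cutoff (R : ℕ) : Continuous (cutoff (E := E) R) := by
  unfold cutoff; fun_prop

theorem cutoff_le_one (R : ℕ) (x : E) : cutoff R x ≤ 1 := max_le zero_le_one (min_le_left _ _)

theorem monotone_cutoff (x : E) : Monotone fun R : ℕ => cutoff R x := by
  intro R S hRS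
  have : (R : ℝ) ≤ S := by exact_mod_cast hRS
  exact max_le_max le_rfl (min_le_min le_rfl (by linarith))

theorem cutoff_eq_one {R : ℕ} {x : E} (h : ‖x‖ ≤ R) : cutoff R x = 1 := by
  unfold cutoff
  rw [min_eq_left (by linarith), max_eq_right zero_le_one]

theorem cutoff_eq_zero {R : ℕ} {x : E} (h : (R : ℝ) + 1 ≤ ‖x‖) : cutoff R x = 0 := by
  unfold cutoff
  exact max_eq_left ((min_le_right _ _).trans (by linarith))

theorem hasCompactSupport_mul_cutoff [ProperSpace E] (F : E → ℝ) (R : ℕ) :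
    HasCompactSupport fun x => F x * cutoff R x := by
  refine HasCompactSupport.intro (isCompact_closedBall (0 : E) (R + 1)) fun x hx => ?_
  rw [mem_closedBall_zero_iff, not_le] at hx
  rw [cutoff_eq_zero hx.le, mul_zero]

end Cutoff

/-- The Kac-Rice formula on a box. -/
theorem setLIntegral_kacRiceOf_box {n m : ℕ} (hn : n ≠ 0) (hmn : 2 * m ≤ n + 1) {θ₀ : ℝ}
    {a b : Fin m → ℝ}
    (hab : ∀ i, a i < b i) (h : (univ.pi fun i => Icc (a i) (b i)) ⊆ regularTuples n m θ₀)
    {F : (Fin (n + 1) → ℝ) → ℝ} (hF : Continuous F) (hF0 : ∀ x, 0 ≤ F x)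
    [IsFiniteMeasure (volume.withDensity fun x => ENNReal.ofReal (F x))] :
    AEMeasurable (kacRiceOf θ₀ (volume.withDensity fun x => ENNReal.ofReal (F x)))
      (volume.restrict (univ.pi fun i => Ioo (a i) (b i))) ∧
    ∫⁻ y in univ.pi fun i => Ioo (a i) (b i),
      kacRiceOf θ₀ (volume.withDensity fun x => ENNReal.ofReal (F x)) y =
        ∫⁻ x, zeroCount θ₀ a b x ∂(volume.withDensity fun x => ENNReal.ofReal (F x)) := by
  set ν := (volume : Measure (Fin (n + 1) → ℝ)).withDensity fun x => ENNReal.ofReal (F x) with hν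
  set Q : Set (Fin m → ℝ) := univ.pi fun i => Ioo (a i) (b i) with hQ
  have hQm : MeasurableSet Q := MeasurableSet.univ_pi fun i => measurableSet_Ioo
  have hνac : ν ≪ volume := withDensity_absolutelyContinuous _ _
  let G : ℕ → (Fin (n + 1) → ℝ) → ℝ := fun R x => F x * cutoff R x
  have hG : ∀ R, Continuous (G R) := fun R => hF.mul (continuous_cutoff R)
  have hGc : ∀ R, HasCompactSupport (G R) := fun R => hasCompactSupport_mul_cutoff F R
  have hGle : ∀ R x, G R x ≤ F x := fun R x => mul_le_of_le_one_right (hF0 x) (cutoff_le_one R x)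
  let μ : ℕ → Measure (Fin (n + 1) → ℝ) := fun R => volume.withDensity fun x => ENNReal.ofReal (G R x)
  have hμfin : ∀ R, IsFiniteMeasure (μ R) := fun R => isFiniteMeasure_withDensity_of_compact (hG R) (hGc R)
  have hμν : ∀ R, μ R ≤ ν := fun R => withDensity_mono <| ae_of_all _ fun x =>
    ENNReal.ofReal_le_ofReal (hGle R x)
  have hlow := fun R => kacLower_of_compact hn hmn hab h (hG R) (hGc R) (hμν R)
  have hN := aemeasurable_zeroCount hn hab h
  have hmono : Tendsto (fun R => ∫⁻ x, zeroCount θ₀ a b x ∂(μ R)) atTop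
      (𝓝 (∫⁻ x, zeroCount θ₀ a b x ∂ν)) := by
    have e1 : ∀ f : (Fin (n + 1) → ℝ) → ℝ, Continuous f →
        ∫⁻ x, zeroCount θ₀ a b x ∂((volume : Measure (Fin (n + 1) → ℝ)).withDensity
          fun x => ENNReal.ofReal (f x)) =
        ∫⁻ x, ENNReal.ofReal (f x) * zeroCount θ₀ a b x := fun f hf =>
      lintegral_withDensity_eq_lintegral_mul₀ hf.measurable.ennreal_ofReal.aemeasurable hN
    simp only [μ, hν, e1 _ (hG _), e1 _ hF]
    refine lintegral_tendsto_of_tendsto_of_monotone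
      (fun R => (hG R).measurable.ennreal_ofReal.aemeasurable.mul hN)
      (ae_of_all _ fun x R S hRS => ?_) (ae_of_all _ fun x => ?_)
    · refine mul_le_mul' (ENNReal.ofReal_le_ofReal ?_) le_rfl
      exact mul_le_mul_of_nonneg_left (monotone_cutoff x hRS) (hF0 x)
    · refine tendsto_const_nhds.congr' ?_
      obtain ⟨R₀, hR₀⟩ := exists_nat_ge ‖x‖
      filter_upwards [eventually_ge_atTop R₀] with R hR
      have : ‖x‖ ≤ R := hR₀.trans (by exact_mod_cast hR)
      simp only [G]
      rw [cutoff_eq_one this, mul_one]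
  -- On Q this gives K ≤ `kacRiceOf θ₀ ν` ≤ `kacLower θ₀ ν`. The integral of K is at least the
  -- expected count and that of the last function at most, so all three agree almost everywhere.
  set K : (Fin m → ℝ) → ℝ≥0∞ := fun y => ⨆ R, kacLower θ₀ (μ R) y with hK
  have hKle : ∀ y ∈ Q, K y ≤ kacRiceOf θ₀ ν y := fun y hy => iSup_le fun R => (hlow R).1 y hy
  have hup : ∫⁻ y in Q, kacLower θ₀ ν y ≤ ∫⁻ x, zeroCount θ₀ a b x ∂ν :=
    setLIntegral_kacLower_le hn hab h ν hνac
  have hdown : ∫⁻ x, zeroCount θ₀ a b x ∂ν ≤ ∫⁻ y in Q, K y := by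
    refine le_of_tendsto' hmono fun R => ?_
    rw [← (hlow R).2]
    exact lintegral_mono fun y => le_iSup (fun R => kacLower θ₀ (μ R) y) R
  have hle : K ≤ᵐ[volume.restrict Q] kacLower θ₀ ν := by
    filter_upwards [ae_restrict_mem hQm] with y hy
    exact (hKle y hy).trans (kacRiceOf_le_kacLower θ₀ ν y)
  -- Ordered functions with equal integrals agree almost everywhere only if the integral is finite.
  have hne : ∫⁻ y in Q, K y ≠ ∞ :=
    ne_top_of_le_ne_top (lintegral_zeroCount_ne_top hn hab h ν hνac) ((lintegral_mono_ae hle).trans hup)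
  have heq : K =ᵐ[volume.restrict Q] kacLower θ₀ ν :=
    ae_eq_of_ae_le_of_lintegral_le hle hne (measurable_kacLower θ₀ ν).aemeasurable (hup.trans hdown)
  have heq' : kacLower θ₀ ν =ᵐ[volume.restrict Q] kacRiceOf θ₀ ν := by
    filter_upwards [heq, ae_restrict_mem hQm] with y hy hyQ
    exact le_antisymm (hy ▸ hKle y hyQ) (kacRiceOf_le_kacLower θ₀ ν y)
  refine ⟨(measurable_kacLower θ₀ ν).aemeasurable.congr heq', ?_⟩
  rw [← lintegral_congr_ae heq']
  exact le_antisymm hup (hdown.trans (lintegral_congr_ae heq).le)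

/-! ### From boxes to Borel sets -/

/-- The scaled zeros as a function of the coefficients. -/
def zeroSet {n : ℕ} (θ₀ : ℝ) (x : Fin (n + 1) → ℝ) : Set ℝ :=
  {y | y ∈ scaledRange n θ₀ ∧ gVal θ₀ x y = 0}

theorem scaledZeros_eq_zeroSet {Ω : Type*} {n : ℕ} (hn : n ≠ 0) (c : Fin (n + 1) → Ω → ℝ) (θ₀ : ℝ)
    (ω : Ω) : scaledZeros c θ₀ ω = zeroSet θ₀ (fun k => c k ω) :=
  Set.ext fun y => mem_scaledZeros_iff hn c θ₀ ω y

/-- Counting measure on the σ-algebra ⊤ makes the count additive with no measurability conditions.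
-/
theorem tupleCount_eq_count {m : ℕ} (S : Set ℝ) (B : Set (Fin m → ℝ)) :
    tupleCount S B = @Measure.count (Fin m → ℝ) ⊤
      ({t | Function.Injective t ∧ ∀ i, t i ∈ S} ∩ B) := by
  rw [@Measure.count_apply _ ⊤ _ trivial]
  unfold tupleCount
  congr 2
  ext t
  simp [and_assoc]

theorem tupleCount_iUnion {m : ℕ} (S : Set ℝ) {B : ℕ → Set (Fin m → ℝ)}
    (hB : Pairwise (Function.onFun Disjoint B)) :
    tupleCount S (⋃ j, B j) = ∑' j, tupleCount S (B j) := by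
  simp only [tupleCount_eq_count, inter_iUnion]
  refine @measure_iUnion _ _ ⊤ _ _ _ (fun i j hij => ?_) fun j => trivial
  exact (hB hij).mono inter_subset_right inter_subset_right

theorem tupleCount_union {m : ℕ} (S : Set ℝ) {A B : Set (Fin m → ℝ)} (h : Disjoint A B) :
    tupleCount S (A ∪ B) = tupleCount S A + tupleCount S B := by
  simp only [tupleCount_eq_count, inter_union_distrib_left]
  exact @measure_union _ ⊤ _ _ _ (h.mono inter_subset_right inter_subset_right) trivial

theorem tupleCount_empty {m : ℕ} (S : Set ℝ) : tupleCount S (∅ : Set (Fin m → ℝ)) = 0 := by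
  simp [tupleCount_eq_count]

/-- Every tuple in the box is regular, hence injective, so distinctness is automatic and the tuples
of zeros form a full Cartesian product. -/
theorem tupleCount_box {n m : ℕ} (hn : n ≠ 0) {θ₀ : ℝ} {a b : Fin m → ℝ} (hab : ∀ i, a i < b i)
    (h : (univ.pi fun i => Icc (a i) (b i)) ⊆ regularTuples n m θ₀) {x : Fin (n + 1) → ℝ}
    (hx : x ≠ 0) :
    tupleCount (zeroSet θ₀ x) (univ.pi fun i => Ioo (a i) (b i)) = zeroCount θ₀ a b x := by
  have hI := Icc_subset_regularRange hab h
  have hfin : ∀ i, {t ∈ Ioo (a i) (b i) | gVal θ₀ x t = 0}.Finite := fun i =>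
    (finite_gVal_zeros hn (θ₀ := θ₀) hx).subset fun y hy =>
      ⟨(hI i (Ioo_subset_Icc_self hy.1)).1, hy.2⟩
  have hset : {t : Fin m → ℝ | Function.Injective t ∧ (∀ i, t i ∈ zeroSet θ₀ x) ∧
      t ∈ univ.pi fun i => Ioo (a i) (b i)} =
      (Fintype.piFinset fun i => (hfin i).toFinset : Finset (Fin m → ℝ)) := by
    ext t
    simp only [mem_ofPred_eq, Finset.mem_coe, Fintype.mem_piFinset, Finite.mem_toFinset]
    constructor
    · rintro ⟨-, h1, h2⟩ i
      exact ⟨h2 i (mem_univ i), (h1 i).2⟩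
    · intro ht
      have hQ : t ∈ univ.pi fun i => Icc (a i) (b i) := fun i _ => Ioo_subset_Icc_self (ht i).1
      exact ⟨(h hQ).1, fun i => ⟨((h hQ).2 i).1, (ht i).2⟩, fun i _ => (ht i).1⟩
  unfold tupleCount zeroCount
  rw [hset, encard_coe_eq_coe_finsetCard, Fintype.card_piFinset]
  have hcard : ∀ i, {t ∈ Ioo (a i) (b i) | gVal θ₀ x t = 0}.encard = (hfin i).toFinset.card :=
    fun i => (hfin i).encard_eq_coe_toFinset_card
  simp only [hcard, ENat.toENNReal_coe]
  exact Nat.cast_prod _ _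

/-- `K` is the density of the factorial moment measure on `B`. -/
def IsCountDensityOn {n m : ℕ} (θ₀ : ℝ) (ν : Measure (Fin (n + 1) → ℝ)) (K : (Fin m → ℝ) → ℝ≥0∞)
    (B : Set (Fin m → ℝ)) : Prop :=
  AEMeasurable (fun x => tupleCount (zeroSet θ₀ x) B) ν ∧
    ∫⁻ x, tupleCount (zeroSet θ₀ x) B ∂ν = ∫⁻ y in B, K y

section CountDensity

variable {n m : ℕ} {θ₀ : ℝ} {ν : Measure (Fin (n + 1) → ℝ)} {K : (Fin m → ℝ) → ℝ≥0∞}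

theorem isCountDensityOn_empty : IsCountDensityOn θ₀ ν K ∅ := by
  simp [IsCountDensityOn, tupleCount_empty]

theorem IsCountDensityOn.iUnion {B : ℕ → Set (Fin m → ℝ)} (hm : ∀ j, MeasurableSet (B j))
    (hd : Pairwise (Function.onFun Disjoint B)) (hB : ∀ j, IsCountDensityOn θ₀ ν K (B j)) :
    IsCountDensityOn θ₀ ν K (⋃ j, B j) := by
  unfold IsCountDensityOn
  simp only [tupleCount_iUnion _ hd]
  refine ⟨AEMeasurable.tsum fun j => (hB j).1, ?_⟩
  rw [lintegral_tsum fun j => (hB j).1, lintegral_iUnion hm hd]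
  exact tsum_congr fun j => (hB j).2

theorem IsCountDensityOn.union {A B : Set (Fin m → ℝ)} (hm : MeasurableSet B)
    (hd : Disjoint A B) (hA : IsCountDensityOn θ₀ ν K A) (hB : IsCountDensityOn θ₀ ν K B) :
    IsCountDensityOn θ₀ ν K (A ∪ B) := by
  unfold IsCountDensityOn
  simp only [tupleCount_union _ hd]
  refine ⟨hA.1.add hB.1, ?_⟩
  rw [lintegral_add_left' hA.1, lintegral_union hm hd, hA.2, hB.2]

/-- Finiteness of the integral over Q permits the subtraction, both pointwise almost surely and
between the integrals. -/
theorem IsCountDensityOn.diff {A Q : Set (Fin m → ℝ)} (hmA : MeasurableSet A)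
    (hmQ : MeasurableSet Q) (hAQ : A ⊆ Q)
    (hQ : IsCountDensityOn θ₀ ν K Q) (hA : IsCountDensityOn θ₀ ν K A)
    (hfin : ∫⁻ y in Q, K y ≠ ∞) : IsCountDensityOn θ₀ ν K (Q \ A) := by
  have hd : Disjoint A (Q \ A) := disjoint_sdiff_right
  have hsum : ∀ x : Fin (n + 1) → ℝ, tupleCount (zeroSet θ₀ x) Q =
      tupleCount (zeroSet θ₀ x) A + tupleCount (zeroSet θ₀ x) (Q \ A) := fun x => by
    rw [← tupleCount_union _ hd, union_sdiff_cancel hAQ]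
  have hfinA : ∫⁻ y in A, K y ≠ ∞ := ne_top_of_le_ne_top hfin (lintegral_mono_set hAQ)
  have hae : ∀ᵐ x ∂ν, tupleCount (zeroSet θ₀ x) A < ∞ :=
    ae_lt_top' hA.1 (by rw [hA.2]; exact hfinA)
  have hmeas : AEMeasurable (fun x => tupleCount (zeroSet θ₀ x) (Q \ A)) ν := by
    refine (hQ.1.sub hA.1).congr ?_
    filter_upwards [hae] with x hx
    simp only [Pi.sub_apply]
    rw [hsum x, ENNReal.add_sub_cancel_left hx.ne]
  refine ⟨hmeas, ?_⟩
  have e1 := hQ.2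
  simp only [hsum] at e1
  rw [lintegral_add_left' hA.1, hA.2, ← union_sdiff_cancel hAQ, lintegral_union (hmQ.diff hmA)
    disjoint_sdiff_right, union_sdiff_cancel hAQ] at e1
  exact (ENNReal.add_right_inj hfinA).1 e1

theorem isPiSystem_boxes (m : ℕ) : IsPiSystem (univ.pi '' (univ.pi fun _ : Fin m =>
    ⋃ (p : ℚ) (q : ℚ) (_ : p < q), {Ioo (p : ℝ) (q : ℝ)})) :=
  IsPiSystem.pi fun _ => Real.isPiSystem_Ioo_rat

theorem generateFrom_boxes (m : ℕ) : MeasurableSpace.generateFrom (univ.pi '' (univ.pi fun _ : Fin m =>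
    ⋃ (p : ℚ) (q : ℚ) (_ : p < q), {Ioo (p : ℝ) (q : ℝ)})) = MeasurableSpace.pi :=
  generateFrom_eq_pi (fun _ => Real.borel_eq_generateFrom_Ioo_rat.symm.trans
    (BorelSpace.measurable_eq (α := ℝ)).symm)
    fun _ => (Real.finiteSpanningSetsInIooRat volume).isCountablySpanning

end CountDensity

theorem isCountDensityOn_box {n m : ℕ} (hn : n ≠ 0) (hmn : 2 * m ≤ n + 1) {θ₀ : ℝ}
    {a b : Fin m → ℝ}
    (h : (univ.pi fun i => Icc (a i) (b i)) ⊆ regularTuples n m θ₀)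
    {F : (Fin (n + 1) → ℝ) → ℝ} (hF : Continuous F) (hF0 : ∀ x, 0 ≤ F x)
    [IsFiniteMeasure (volume.withDensity fun x => ENNReal.ofReal (F x))] :
    IsCountDensityOn θ₀ (volume.withDensity fun x => ENNReal.ofReal (F x))
      (kacRiceOf θ₀ (volume.withDensity fun x => ENNReal.ofReal (F x)))
      (univ.pi fun i => Ioo (a i) (b i)) := by
  by_cases hab : ∀ i, a i < b i
  · have hac : (volume.withDensity fun x => ENNReal.ofReal (F x)) ≪
      (volume : Measure (Fin (n + 1) → ℝ)) := withDensity_absolutelyContinuous _ _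
    have hae : (fun x => tupleCount (zeroSet θ₀ x) (univ.pi fun i => Ioo (a i) (b i)))
        =ᵐ[volume.withDensity fun x => ENNReal.ofReal (F x)] zeroCount θ₀ a b := by
      refine hac.ae_le ?_
      filter_upwards [ae_eval_ne_zero (n := n) 0] with x hx
      exact tupleCount_box hn hab h fun h0 => hx (by rw [h0]; rfl)
    refine ⟨((aemeasurable_zeroCount hn hab h).mono_ac hac).congr hae.symm, ?_⟩
    rw [lintegral_congr_ae hae, (setLIntegral_kacRiceOf_box hn hmn hab h hF hF0).2]
  -- Degenerate boxes are allowed because intersections of boxes may be empty.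
  · have : (univ.pi fun i => Ioo (a i) (b i)) = ∅ := by
      push Not at hab
      obtain ⟨i, hi⟩ := hab
      exact univ_pi_eq_empty (Ioo_eq_empty (not_lt.2 hi))
    rw [this]
    exact isCountDensityOn_empty

/-- π-λ induction with rational boxes as generators. The traces of generators on the fixed box are
boxes, and finite mass there handles complements. -/
theorem isCountDensityOn_inter_box {n m : ℕ} (hn : n ≠ 0) (hmn : 2 * m ≤ n + 1) {θ₀ : ℝ}
    {a b : Fin m → ℝ} (hab : ∀ i, a i < b i)
    (h : (univ.pi fun i => Icc (a i) (b i)) ⊆ regularTuples n m θ₀)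
    {F : (Fin (n + 1) → ℝ) → ℝ} (hF : Continuous F) (hF0 : ∀ x, 0 ≤ F x)
    [IsFiniteMeasure (volume.withDensity fun x => ENNReal.ofReal (F x))]
    {B : Set (Fin m → ℝ)} (hB : MeasurableSet B) :
    IsCountDensityOn θ₀ (volume.withDensity fun x => ENNReal.ofReal (F x))
      (kacRiceOf θ₀ (volume.withDensity fun x => ENNReal.ofReal (F x)))
      (B ∩ univ.pi fun i => Ioo (a i) (b i)) := by
  set ν := (volume : Measure (Fin (n + 1) → ℝ)).withDensity fun x => ENNReal.ofReal (F x) with hν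
  set Q : Set (Fin m → ℝ) := univ.pi fun i => Ioo (a i) (b i) with hQ
  have hQm : MeasurableSet Q := MeasurableSet.univ_pi fun i => measurableSet_Ioo
  have hQd : IsCountDensityOn θ₀ ν (kacRiceOf θ₀ ν) Q := isCountDensityOn_box hn hmn h hF hF0
  have hfin : ∫⁻ y in Q, kacRiceOf θ₀ ν y ≠ ∞ := by
    rw [(setLIntegral_kacRiceOf_box hn hmn hab h hF hF0).2]
    exact lintegral_zeroCount_ne_top hn hab h ν (withDensity_absolutelyContinuous _ _)
  induction B, hB using MeasurableSpace.induction_on_inter (generateFrom_boxes m).symm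
    (isPiSystem_boxes m) with
  | empty => rw [empty_inter]; exact isCountDensityOn_empty
  | basic t ht =>
    obtain ⟨s, hs, rfl⟩ := ht
    have hs' : ∀ i, ∃ p q : ℝ, s i = Ioo p q := fun i => by
      have := hs i (mem_univ i)
      simp only [mem_iUnion, mem_singleton_iff] at this
      obtain ⟨p, q, -, hpq⟩ := this
      exact ⟨p, q, hpq⟩
    choose p q hpq using hs'
    have he : univ.pi s ∩ Q = univ.pi fun i => Ioo (max (p i) (a i)) (min (q i) (b i)) := by
      rw [hQ, ← pi_inter_distrib]
      congr 1
      funext i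
      rw [hpq i, Ioo_inter_Ioo]
    rw [he]
    refine isCountDensityOn_box hn hmn (Subset.trans ?_ h) hF hF0
    exact Set.pi_mono fun i _ => Icc_subset_Icc (le_max_right _ _) (min_le_right _ _)
  | compl t ht ih =>
    have : tᶜ ∩ Q = Q \ (t ∩ Q) := by
      ext y; simp only [mem_inter_iff, mem_compl_iff, Set.mem_sdiff]; tauto
    rw [this]
    exact IsCountDensityOn.diff (ht.inter hQm) hQm inter_subset_right hQd ih hfin
  | iUnion f hd hm ih =>
    rw [iUnion_inter]
    exact IsCountDensityOn.iUnion (fun j => (hm j).inter hQm)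
      (fun i j hij => (hd hij).mono inter_subset_left inter_subset_left) ih

theorem exists_rat_box {m : ℕ} {U : Set (Fin m → ℝ)} (hU : IsOpen U) {y : Fin m → ℝ} (hy : y ∈ U) :
    ∃ a b : Fin m → ℚ, (∀ i, (a i : ℝ) < b i) ∧
      (univ.pi fun i => Icc (a i : ℝ) (b i)) ⊆ U ∧ y ∈ univ.pi fun i => Ioo (a i : ℝ) (b i) := by
  obtain ⟨ε, hε, hball⟩ := Metric.isOpen_iff.1 hU y hy
  choose a ha using fun i => exists_rat_btwn (show y i - ε / 2 < y i by linarith)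
  choose b hb using fun i => exists_rat_btwn (show y i < y i + ε / 2 by linarith)
  refine ⟨a, b, fun i => (ha i).2.trans (hb i).1, fun z hz => hball ?_,
    fun i _ => ⟨(ha i).2, (hb i).1⟩⟩
  rw [Metric.mem_ball, dist_pi_lt_iff hε]
  intro i
  have h1 := hz i (mem_univ i)
  have h2 := ha i
  have h3 := hb i
  rw [Real.dist_eq, abs_lt]
  constructor <;> linarith [h1.1, h1.2, h2.1, h3.2]

/-- An open set is a countable union of open boxes whose closures lie in the set. -/
theorem exists_box_cover {m : ℕ} {U : Set (Fin m → ℝ)} (hU : IsOpen U) :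
    ∃ Q : ℕ → Set (Fin m → ℝ), (∀ j, Q j = ∅ ∨ ∃ a b : Fin m → ℝ, (∀ i, a i < b i) ∧
      (univ.pi fun i => Icc (a i) (b i)) ⊆ U ∧ Q j = univ.pi fun i => Ioo (a i) (b i)) ∧
      ⋃ j, Q j = U := by
  let box : (Fin m → ℚ) × (Fin m → ℚ) → Set (Fin m → ℝ) := fun p =>
    univ.pi fun i => Ioo (p.1 i : ℝ) (p.2 i)
  let I : Set ((Fin m → ℚ) × (Fin m → ℚ)) := {p | (∀ i, (p.1 i : ℝ) < p.2 i) ∧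
    (univ.pi fun i => Icc (p.1 i : ℝ) (p.2 i)) ⊆ U}
  -- Adding ∅ makes the countable family nonempty, so that it can be enumerated by ℕ.
  obtain ⟨Q, hQ⟩ := ((I.to_countable.image box).insert ∅).exists_eq_range (insert_nonempty _ _)
  have hbox : ∀ p ∈ I, box p ⊆ U := fun p hp =>
    (Set.pi_mono fun i _ => Ioo_subset_Icc_self).trans hp.2
  have hmem : ∀ j, Q j = ∅ ∨ ∃ p ∈ I, box p = Q j := fun j => by
    have : Q j ∈ insert ∅ (box '' I) := hQ ▸ mem_range_self j
    simpa using this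
  refine ⟨Q, fun j => (hmem j).imp_right ?_, Subset.antisymm (iUnion_subset fun j => ?_) ?_⟩
  · rintro ⟨p, hp, he⟩
    exact ⟨_, _, hp.1, hp.2, he.symm⟩
  · rcases hmem j with h | ⟨p, hp, he⟩
    · rw [h]; exact empty_subset _
    · rw [← he]; exact hbox p hp
  · intro y hy
    obtain ⟨a, b, hab, hsub, hyab⟩ := exists_rat_box hU hy
    have : box (a, b) ∈ range Q := hQ ▸ mem_insert_of_mem _ (mem_image_of_mem box ⟨hab, hsub⟩)
    obtain ⟨j, hj⟩ := this
    exact mem_iUnion.2 ⟨j, hj ▸ hyab⟩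

theorem isOpen_regularTuples (n m : ℕ) (θ₀ : ℝ) : IsOpen (regularTuples n m θ₀) := by
  have : regularTuples n m θ₀ = (⋂ (i : Fin m) (j : Fin m) (_ : i ≠ j), {y | y i ≠ y j}) ∩
      ⋂ i : Fin m, {y | y i ∈ regularRange n θ₀} := by
    ext y
    simp only [regularTuples, mem_inter_iff, mem_iInter, mem_ofPred_eq]
    refine and_congr_left fun _ => ⟨fun h i j hij => h.ne hij, fun h i j hij => ?_⟩
    by_contra hne
    exact h i j hne hij
  rw [this]
  refine IsOpen.inter ?_ (isOpen_iInter_of_finite fun i =>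
    (isOpen_regularRange n θ₀).preimage (continuous_apply i))
  exact isOpen_iInter_of_finite fun i => isOpen_iInter_of_finite fun j =>
    isOpen_iInter_of_finite fun _ => isOpen_ne_fun (continuous_apply i) (continuous_apply j)

theorem isCountDensityOn_inter_regularTuples {n m : ℕ} (hn : n ≠ 0) (hmn : 2 * m ≤ n + 1) {θ₀ : ℝ}
    {F : (Fin (n + 1) → ℝ) → ℝ} (hF : Continuous F) (hF0 : ∀ x, 0 ≤ F x)
    [IsFiniteMeasure (volume.withDensity fun x => ENNReal.ofReal (F x))]
    {B : Set (Fin m → ℝ)} (hB : MeasurableSet B) :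
    IsCountDensityOn θ₀ (volume.withDensity fun x => ENNReal.ofReal (F x))
      (kacRiceOf θ₀ (volume.withDensity fun x => ENNReal.ofReal (F x)))
      (B ∩ regularTuples n m θ₀) := by
  obtain ⟨Q, hQ, hU⟩ := exists_box_cover (isOpen_regularTuples n m θ₀)
  have hQm : ∀ j, MeasurableSet (Q j) := fun j => by
    rcases hQ j with h | ⟨a, b, -, -, h⟩
    · rw [h]; exact MeasurableSet.empty
    · rw [h]; exact MeasurableSet.univ_pi fun i => measurableSet_Ioo
  have hdm : ∀ j, MeasurableSet (disjointed Q j) := fun j => MeasurableSet.disjointed hQm j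
  rw [← hU, ← iUnion_disjointed, inter_iUnion]
  refine IsCountDensityOn.iUnion (fun j => hB.inter (hdm j))
    (fun i j hij => (disjoint_disjointed Q hij).mono inter_subset_right inter_subset_right)
    fun j => ?_
  -- Each disjoint piece lies in a single box of the cover, where the result for Borel subsets of a
  -- box applies.
  have he : B ∩ disjointed Q j = (B ∩ disjointed Q j) ∩ Q j :=
    (inter_eq_left.2 (inter_subset_right.trans (disjointed_subset Q j))).symm
  rw [he]
  rcases hQ j with h | ⟨a, b, hab, hsub, h⟩
  · rw [h, inter_empty]; exact isCountDensityOn_empty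
  · rw [h]
    exact isCountDensityOn_inter_box hn hmn hab hsub hF hF0 (hB.inter (hdm j))

theorem aemeasurable_kacRiceOf_regularTuples {n m : ℕ} (hn : n ≠ 0) (hmn : 2 * m ≤ n + 1) {θ₀ : ℝ}
    {F : (Fin (n + 1) → ℝ) → ℝ} (hF : Continuous F) (hF0 : ∀ x, 0 ≤ F x)
    [IsFiniteMeasure (volume.withDensity fun x => ENNReal.ofReal (F x))] :
    AEMeasurable (kacRiceOf θ₀ (volume.withDensity fun x => ENNReal.ofReal (F x)))
      (volume.restrict (regularTuples n m θ₀)) := by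
  obtain ⟨Q, hQ, hU⟩ := exists_box_cover (isOpen_regularTuples n m θ₀)
  rw [← hU, aemeasurable_iUnion_iff]
  intro j
  rcases hQ j with h | ⟨a, b, hab, hsub, h⟩
  · rw [h, Measure.restrict_empty]; exact aemeasurable_zero_measure
  · rw [h]
    exact (setLIntegral_kacRiceOf_box hn hmn hab hsub hF hF0).1

/-! ### Tuples that are not regular -/

theorem angle_eq_zero_subsingleton {n : ℕ} (hn : n ≠ 0) (θ₀ : ℝ) :
    {s | angle n θ₀ s = 0}.Subsingleton :=
  fun _ hs _ ht => angle_injective hn θ₀ (hs.trans ht.symm)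

theorem ae_gVal_ne_zero_of_angle_eq_zero {n : ℕ} (hn : n ≠ 0) (θ₀ : ℝ) :
    ∀ᵐ x : Fin (n + 1) → ℝ, ∀ s ∈ scaledRange n θ₀, angle n θ₀ s = 0 → gVal θ₀ x s ≠ 0 := by
  by_cases h : ∃ s ∈ scaledRange n θ₀, angle n θ₀ s = 0
  · obtain ⟨s, hs, hs0⟩ := h
    filter_upwards [ae_gVal_ne_zero hs] with x hx t _ ht0
    rwa [angle_eq_zero_subsingleton hn θ₀ ht0 hs0]
  · push Not at h
    exact ae_of_all _ fun x s hs hs0 => absurd hs0 (h s hs)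

/-- A tuple in the range fails to be regular only on a diagonal, which is a proper subspace, or
where one coordinate takes the single value with θ = 0. -/
theorem ae_regularTuples {n : ℕ} (hn : n ≠ 0) (m : ℕ) (θ₀ : ℝ) :
    ∀ᵐ y : Fin m → ℝ, (∀ i, y i ∈ scaledRange n θ₀) → y ∈ regularTuples n m θ₀ := by
  have h1 : ∀ i : Fin m, ∀ᵐ y : Fin m → ℝ, angle n θ₀ (y i) ≠ 0 := fun i => by
    have h0 : ∀ᵐ s : ℝ, angle n θ₀ s ≠ 0 := by
      rw [ae_iff]
      simp only [not_not]
      exact (angle_eq_zero_subsingleton hn θ₀).measure_zero _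
    exact (Measure.quasiMeasurePreserving_eval (fun _ : Fin m => (volume : Measure ℝ)) i).ae h0
  have h2 : ∀ i j : Fin m, ∀ᵐ y : Fin m → ℝ, i ≠ j → y i ≠ y j := fun i j => by
    by_cases hij : i = j
    · exact ae_of_all _ fun y h => absurd hij h
    · let L : (Fin m → ℝ) →ₗ[ℝ] ℝ :=
        LinearMap.proj (R := ℝ) (φ := fun _ : Fin m => ℝ) i - LinearMap.proj j
      have hL : LinearMap.ker L ≠ ⊤ := fun h => by
        have h3 : (Pi.single i 1 : Fin m → ℝ) ∈ LinearMap.ker L := h ▸ Submodule.mem_top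
        simp [L, Ne.symm hij] at h3
      have h4 := Measure.addHaar_submodule (volume : Measure (Fin m → ℝ)) _ hL
      filter_upwards [measure_eq_zero_iff_ae_notMem.1 h4] with y hy _ he
      exact hy (by simp [L, he])
  filter_upwards [ae_all_iff.2 h1, ae_all_iff.2 fun i => ae_all_iff.2 (h2 i)] with y ha hi hU
  refine ⟨fun i j hij => ?_, fun i => ⟨hU i, ha i⟩⟩
  by_contra hne
  exact hi i j hne hij

theorem isCountDensityOn_of_subset {n m : ℕ} (hn : n ≠ 0) (hmn : 2 * m ≤ n + 1) {θ₀ : ℝ}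
    {F : (Fin (n + 1) → ℝ) → ℝ} (hF : Continuous F) (hF0 : ∀ x, 0 ≤ F x)
    [IsFiniteMeasure (volume.withDensity fun x => ENNReal.ofReal (F x))]
    {B : Set (Fin m → ℝ)} (hB : MeasurableSet B) (hBU : B ⊆ univ.pi fun _ => scaledRange n θ₀) :
    IsCountDensityOn θ₀ (volume.withDensity fun x => ENNReal.ofReal (F x))
      (kacRiceOf θ₀ (volume.withDensity fun x => ENNReal.ofReal (F x))) B := by
  have hm := (isOpen_regularTuples n m θ₀).measurableSet
  rw [← inter_union_sdiff B (regularTuples n m θ₀)]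
  refine IsCountDensityOn.union (hB.diff hm) (disjoint_sdiff_right.mono_left inter_subset_right)
    (isCountDensityOn_inter_regularTuples hn hmn hF hF0 hB) ?_
  have hzero : (fun x => tupleCount (zeroSet θ₀ x) (B \ regularTuples n m θ₀))
      =ᵐ[volume.withDensity fun x => ENNReal.ofReal (F x)] fun _ => 0 := by
    refine (withDensity_absolutelyContinuous _ _).ae_le ?_
    filter_upwards [ae_gVal_ne_zero_of_angle_eq_zero hn θ₀] with x hx
    have : {t : Fin m → ℝ | Function.Injective t ∧ (∀ i, t i ∈ zeroSet θ₀ x) ∧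
        t ∈ B \ regularTuples n m θ₀} = ∅ := by
      -- Counted tuples are injective, so a nonregular one has a coordinate with θ = 0, where almost
      -- surely g_n has no zero.
      refine eq_empty_iff_forall_notMem.2 fun t ⟨hinj, hz, _, hreg⟩ => hreg ⟨hinj, fun i => ?_⟩
      exact ⟨(hz i).1, fun h0 => hx (t i) (hz i).1 h0 (hz i).2⟩
    simp only [tupleCount, this, encard_empty, ENat.toENNReal_zero]
  refine ⟨aemeasurable_const.congr hzero.symm, ?_⟩
  rw [lintegral_congr_ae hzero, lintegral_zero, setLIntegral_measure_zero]
  refine measure_mono_null (fun y hy => ?_) (ae_iff.1 (ae_regularTuples hn m θ₀))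
  exact fun h => hy.2 (h fun i => hBU hy.1 i (mem_univ i))

theorem aemeasurable_kacRiceOf {n m : ℕ} (hn : n ≠ 0) (hmn : 2 * m ≤ n + 1) {θ₀ : ℝ}
    {F : (Fin (n + 1) → ℝ) → ℝ} (hF : Continuous F) (hF0 : ∀ x, 0 ≤ F x)
    [IsFiniteMeasure (volume.withDensity fun x => ENNReal.ofReal (F x))] :
    AEMeasurable (kacRiceOf θ₀ (volume.withDensity fun x => ENNReal.ofReal (F x)))
      (volume.restrict (univ.pi fun _ : Fin m => scaledRange n θ₀)) := by
  refine (aemeasurable_kacRiceOf_regularTuples hn hmn hF hF0).mono_measure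
    (Measure.restrict_mono_ae ?_)
  filter_upwards [ae_regularTuples hn m θ₀] with y hy hU
  exact hy fun i => hU i (mem_univ i)

/-! ### Absolute continuity of the joint law and conclusion -/

/-- An absolutely continuous measure has its point density as a density. -/
theorem withDensity_pointDensity {E : Type*} [NormedAddCommGroup E] [NormedSpace ℝ E]
    [FiniteDimensional ℝ E] [MeasureSpace E] [BorelSpace E] [SecondCountableTopology E]
    [(volume : Measure E).IsAddHaarMeasure] [Nontrivial E] (ρ : Measure E) [IsFiniteMeasure ρ]
    (h : ρ ≪ volume) : volume.withDensity (pointDensity ρ) = ρ := by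
  refine Eq.trans ?_ (Measure.withDensity_rnDeriv_eq ρ volume h)
  refine withDensity_congr_ae ?_
  filter_upwards [Besicovitch.ae_tendsto_rnDeriv ρ volume] with z hz
  unfold pointDensity
  refine Tendsto.liminf_eq (hz.congr' ?_)
  filter_upwards [self_mem_nhdsWithin] with ε hε
  -- Besicovitch differentiation uses closed balls and `pointDensity` open ones; spheres are null
  -- for both measures.
  have hs : volume (Metric.sphere z ε) = 0 :=
    Measure.addHaar_sphere_of_ne_zero volume z (ne_of_gt hε)
  have hball : ∀ κ : Measure E, κ (Metric.sphere z ε) = 0 →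
      κ (Metric.closedBall z ε) = κ (Metric.ball z ε) := fun κ hκ => by
    refine le_antisymm ?_ (measure_mono Metric.ball_subset_closedBall)
    rw [← Metric.ball_union_sphere]
    exact (measure_union_le _ _).trans (by rw [hκ, add_zero])
  rw [hball ρ (h hs), hball volume hs]

/-- A surjective linear map sends Lebesgue measure to a multiple of Lebesgue measure; the factor may
be ∞, which does no harm to absolute continuity. -/
theorem map_evalMap_absolutelyContinuous {n m : ℕ} (hn : n ≠ 0) (hmn : 2 * m ≤ n + 1) {θ₀ : ℝ}
    {y : Fin m → ℝ} (hy : y ∈ regularTuples n m θ₀) {ν : Measure (Fin (n + 1) → ℝ)}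
    (hν : ν ≪ volume) : ν.map (evalMap θ₀ y) ≪ volume := by
  have hmeas := (evalMap (n := n) θ₀ y).continuous.measurable
  refine (hν.map hmeas).trans ?_
  obtain ⟨C, -, hC⟩ := LinearMap.exists_map_addHaar_eq_smul_addHaar
    (evalMap (n := n) θ₀ y).toLinearMap volume volume (surjective_evalMap hn hmn hy)
  have : Measure.map (evalMap (n := n) θ₀ y) volume = C • volume := hC
  rw [this]
  exact Measure.smul_absolutelyContinuous

/-- The joint law of independent variables with a common density. -/
theorem map_eq_withDensity_prod {Ω : Type*} [MeasurableSpace Ω] {P : Measure Ω}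
    [IsProbabilityMeasure P] {r : ℝ → ℝ} (hr : Measurable r) (hr0 : ∀ t, 0 ≤ r t) {n : ℕ}
    {c : Fin (n + 1) → Ω → ℝ} (hc : ∀ k, Measurable (c k)) (hindep : iIndepFun c P)
    (hlaw : ∀ k, P.map (c k) = volume.withDensity (fun t => ENNReal.ofReal (r t))) :
    P.map (fun ω k => c k ω) = volume.withDensity fun x => ENNReal.ofReal (∏ k, r (x k)) := by
  have hprob : IsProbabilityMeasure (volume.withDensity fun t => ENNReal.ofReal (r t)) :=
    hlaw 0 ▸ Measure.isProbabilityMeasure_map (hc 0).aemeasurable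
  rw [(iIndepFun_iff_map_fun_eq_pi_map fun k => (hc k).aemeasurable).1 hindep]
  simp only [hlaw]
  rw [pi_withDensity_eq hr.ennreal_ofReal]
  simp only [ENNReal.ofReal_prod_of_nonneg fun _ _ => hr0 _]

theorem jointLaw_eq_map {Ω : Type*} [MeasurableSpace Ω] (P : Measure Ω) {n m : ℕ}
    {c : Fin (n + 1) → Ω → ℝ} (hc : ∀ k, Measurable (c k)) (θ₀ : ℝ) (y : Fin m → ℝ) :
    jointLaw P c θ₀ y = (P.map fun ω k => c k ω).map (evalMap θ₀ y) := by
  rw [Measure.map_map (evalMap (n := n) θ₀ y).continuous.measurable (measurable_pi_iff.2 hc)]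
  rfl

theorem kacRice_eq_kacRiceOf {Ω : Type*} [MeasurableSpace Ω] (P : Measure Ω) {n m : ℕ}
    {c : Fin (n + 1) → Ω → ℝ} (hc : ∀ k, Measurable (c k)) (θ₀ : ℝ) (y : Fin m → ℝ) :
    kacRice P c θ₀ y = kacRiceOf θ₀ (P.map fun ω k => c k ω) y := by
  simp only [kacRice, kacRiceOf, jointDensity, jointLaw_eq_map P hc]

theorem proposition7p1 {Ω : Type*} [MeasurableSpace Ω] (P : Measure Ω) [IsProbabilityMeasure P]
    (r : ℝ → ℝ) (hr : Continuous r) (hr_nonneg : ∀ t, 0 ≤ r t)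
    (n m : ℕ) (hm : 1 ≤ m) (hmn : 2 * m ≤ n + 1)
    (c : Fin (n + 1) → Ω → ℝ) (hc : ∀ k, Measurable (c k)) (hindep : iIndepFun c P)
    (hlaw : ∀ k, P.map (c k) = volume.withDensity (fun t => ENNReal.ofReal (r t)))
    (hmean : ∀ k, ∫ ω, c k ω ∂P = 0) (hvar : ∀ k, ∫ ω, (c k ω) ^ 2 ∂P = 1)
    (θ₀ : ℝ) :
    (∀ y : Fin m → ℝ, Function.Injective y →
      (∀ i, y i ∈ scaledRange n θ₀ ∧ angle n θ₀ (y i) ≠ 0) →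
      jointLaw P c θ₀ y = volume.withDensity (fun z => jointDensity P c θ₀ z.1 z.2 y)) ∧
    IsCorrelationFunctionOn P (scaledZeros c θ₀) (scaledRange n θ₀)
      (fun y : Fin m → ℝ => kacRice P c θ₀ y) := by
  have hn : n ≠ 0 := by omega
  have hX : Measurable fun ω k => c k ω := measurable_pi_iff.2 hc
  have hν := map_eq_withDensity_prod hr.measurable hr_nonneg hc hindep hlaw
  have hF : Continuous fun x : Fin (n + 1) → ℝ => ∏ k, r (x k) :=
    continuous_finsetProd _ fun k _ => hr.comp (continuous_apply k)
  have hF0 : ∀ x : Fin (n + 1) → ℝ, 0 ≤ ∏ k, r (x k) := fun x =>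
    Finset.prod_nonneg fun k _ => hr_nonneg _
  have hprob : IsProbabilityMeasure (P.map fun ω k => c k ω) :=
    Measure.isProbabilityMeasure_map hX.aemeasurable
  have hfin : IsFiniteMeasure ((volume : Measure (Fin (n + 1) → ℝ)).withDensity
      fun x => ENNReal.ofReal (∏ k, r (x k))) := by
    rw [← hν]; infer_instance
  have hac : (P.map fun ω k => c k ω) ≪ volume := by
    rw [hν]; exact withDensity_absolutelyContinuous _ _
  refine ⟨fun y hinj hy => ?_, ?_, fun B hB hBU => ?_, fun B hB hBU => ?_⟩
  -- The condition m ≥ 1 makes the target space nontrivial, as `withDensity_pointDensity` requires.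
  · have : Nonempty (Fin m) := ⟨⟨0, hm⟩⟩
    have hρ : jointLaw P c θ₀ y ≪ volume := by
      rw [jointLaw_eq_map P hc]
      exact map_evalMap_absolutelyContinuous hn hmn ⟨hinj, hy⟩ hac
    have hρfin : IsFiniteMeasure (jointLaw P c θ₀ y) := by
      rw [jointLaw_eq_map P hc]; infer_instance
    exact (withDensity_pointDensity _ hρ).symm
  · simp only [kacRice_eq_kacRiceOf P hc, hν]
    exact aemeasurable_kacRiceOf hn hmn hF hF0
  · simp only [scaledZeros_eq_zeroSet hn]
    refine AEMeasurable.comp_measurable (g := fun x => tupleCount (zeroSet θ₀ x) B) ?_ hX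
    rw [hν]
    exact (isCountDensityOn_of_subset hn hmn hF hF0 hB hBU).1
  · simp only [scaledZeros_eq_zeroSet hn, kacRice_eq_kacRiceOf P hc]
    have h := isCountDensityOn_of_subset hn hmn hF hF0 hB hBU
    rw [← hν] at h
    rw [← h.2, lintegral_map' h.1 hX.aemeasurable]

end
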